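/- A signed graph $(G,\Sigma)$ is a finite loopless graph $G=(V,E)$ (parallel edges allowed) with a set $\Sigma\subseteq E$ of odd edges; the other edges are even. A path or cycle is odd if it contains an odd number of odd edges, and even otherwise. $(G,\Sigma)$ is bipartite if it has no odd cycle. $S(G,\Sigma)$ is the set of real symmetric $V\times V$ matrices $A=[a_{i,j}]$ such that, for $i\ne j$: $a_{i,j}<0$ if $i,j$ are joined by edges all of which are even; $a_{i,j}>0$ if $i,j$ are joined by edges all of which are odd; $a_{i,j}=0$ if $i,j$ are non-adjacent (no condition if they are joined by both odd and even edges, and no condition on the diagonal). $A\in S(G,\Sigma)$ has the Strong Arnold Property (SAP) if $X=0$ is the only real symmetric matrix with $AX=0$ and $x_{i,j}=0$ whenever $i=j$ or $i,j$ are adjacent. $\nu(G,\Sigma)$ is the largest nullity of a positive semidefinite $A\in S(G,\Sigma)$ that has the SAP. Let $E_1,E_2$ be a partition of $E(G)$ into two nonempty sets, let $V_i$ be the set of ends of edges in $E_i$, and let $(\tilde G_i,\tilde\Sigma_i)$ be the signed graph with $\tilde G_i=(V_i,E_i)$ and $\tilde\Sigma_i=E_i\cap\Sigma$. If $k=|V_1\cap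 V_2|\le 1$, then $(\tilde G_1,\tilde\Sigma_1)$ and $(\tilde G_2,\tilde\Sigma_2)$ form a $k$-split of $(G,\Sigma)$. Suppose that $V_1\cap V_2=\{u,v\}$ with $u\neq v$, and that for $i=1,2$, $\tilde G_i$ is connected and $(\tilde G_i,\tilde\Sigma_i)$ is not isomorphic to a signed subgraph of $K_2^{=}$, the signed graph consisting of two vertices joined by one odd and one even edge. For $\{i,j\}=\{1,2\}$, let $(G_i,\Sigma_i)$ be obtained from $(\tilde G_i,\tilde\Sigma_i)$ by adding, between $u$ and $v$, an odd and an even edge if $(\tilde G_j,\tilde\Sigma_j)$ is not bipartite, and a single edge if it is bipartite, this edge being odd if and only if $(\tilde G_j,\tilde\Sigma_j)$ has an odd path between $u$ and $v$. Then $(G_1,\Sigma_1)$ and $(G_2,\Sigma_2)$ form a $2$-split of $(G,\Sigma)$. Theorem. Let $(G_1,\Sigma_1)$ and $(G_2,\Sigma_2)$ form a $0$-, $1$-, or $2$-split of $(G,\Sigma)$, where in the case of a $2$-split we assume that, for $i=1,2$, if $(\tilde G_i,\tilde\Sigma_i)$ is not bipartite, then it has both an odd and an even path between $u$ and $v$ (this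 holds automatically if $G$ is $2$-connected). Then $$\nu(G,\Sigma)=\max\{\nu(G_1,\Sigma_1),\nu(G_2,\Sigma_2)\}.$$ -/

import Mathlib

open scoped Graph

/-- A signed graph `(G, Σ)`: a loopless multigraph together with its set `odd = Σ` of odd edges. -/
structure SignedGraph (α β : Type*) where
  graph : Graph α β
  loopless : graph.Loopless
  odd : Set β
  odd_subset : odd ⊆ E(graph)

namespace SignedGraph

variable {α β α' β' : Type*}

/-! ### Walks, paths, cycles -/

/-- Walks in a signed graph. -/
inductive Walk (G : SignedGraph α β) : α → α → Type _
  | nil (x : α) (hx : x ∈ V(G.graph)) : Walk G x x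
  | cons {x y z : α} (e : β) (h : G.graph.IsLink e x y) (p : Walk G y z) : Walk G x z

namespace Walk

variable {G : SignedGraph α β}

/-- The list of vertices of a walk, in order. -/
def support : {x y : α} → Walk G x y → List α
  | _, _, nil x _ => [x]
  | x, _, cons _ _ p => x :: p.support

/-- The list of edges of a walk, in order. -/
def edges : {x y : α} → Walk G x y → List β
  | _, _, nil _ _ => []
  | _, _, cons e _ p => e :: p.edges

open Classical in
/-- The number of odd edges traversed by a walk. -/
noncomputable def oddCount {x y : α} (p : Walk G x y) : ℕ :=
  p.edges.countP (fun e => decide (e ∈ G.odd))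

/-- A path is a walk without repeated vertices. -/
def IsPath {x y : α} (p : Walk G x y) : Prop := p.support.Nodup

/-- A cycle is a nontrivial closed walk without repeated edges and without repeated vertices other
than the common first and last one. Two parallel edges form a cycle. -/
def IsCycle {x : α} (p : Walk G x x) : Prop :=
  p.edges ≠ [] ∧ p.edges.Nodup ∧ p.support.tail.Nodup

end Walk

/-- There is an odd path between `u` and `v`. -/
def HasOddPath (G : SignedGraph α β) (u v : α) : Prop :=
  ∃ p : Walk G u v, p.IsPath ∧ Odd p.oddCount

/-- There is an even path between `u` and `v`. -/
def HasEvenPath (G : SignedGraph α β) (u v : α) : Prop :=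
  ∃ p : Walk G u v, p.IsPath ∧ Even p.oddCount

/-- A signed graph is bipartite if it has no odd cycle. -/
def IsBipartite (G : SignedGraph α β) : Prop :=
  ∀ (x : α) (p : Walk G x x), p.IsCycle → ¬ Odd p.oddCount

/-- Connectedness. -/
def IsConnected (G : SignedGraph α β) : Prop :=
  V(G.graph).Nonempty ∧ ∀ x ∈ V(G.graph), ∀ y ∈ V(G.graph), Nonempty (Walk G x y)

/-! ### The parameter `ν` -/

/-- Some even edge connects `x` and `y`. -/
def EvenAdj (G : SignedGraph α β) (x y : α) : Prop := ∃ e, e ∉ G.odd ∧ G.graph.IsLink e x y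

/-- Some odd edge connects `x` and `y`. -/
def OddAdj (G : SignedGraph α β) (x y : α) : Prop := ∃ e, e ∈ G.odd ∧ G.graph.IsLink e x y

/-- The set `S(G, Σ)` of symmetric matrices described by the signed graph. -/
def matrixSet (G : SignedGraph α β) : Set (Matrix V(G.graph) V(G.graph) ℝ) :=
  {A | A.IsSymm ∧ ∀ i j : V(G.graph), i ≠ j →
    (G.EvenAdj i j → ¬ G.OddAdj i j → A i j < 0) ∧
    (G.OddAdj i j → ¬ G.EvenAdj i j → 0 < A i j) ∧
    (¬ G.graph.Adj i j → A i j = 0)}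

/-- The Strong Arnold Property. -/
def HasSAP (G : SignedGraph α β) [Fintype V(G.graph)]
    (A : Matrix V(G.graph) V(G.graph) ℝ) : Prop :=
  ∀ X : Matrix V(G.graph) V(G.graph) ℝ, X.IsSymm →
    (∀ i j : V(G.graph), (G.graph.Adj i j ∨ i = j) → X i j = 0) → A * X = 0 → X = 0

/-- The nullities of the positive semidefinite matrices in `S(G, Σ)` that have the SAP. -/
def nullities (G : SignedGraph α β) [Fintype V(G.graph)] : Set ℕ :=
  {k | ∃ A ∈ G.matrixSet, A.PosSemidef ∧ G.HasSAP A ∧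
    Module.finrank ℝ (LinearMap.ker A.mulVecLin) = k}

/-- `ν(G, Σ)`: the largest nullity of a positive semidefinite matrix in `S(G, Σ)` that has the
SAP. (The set of these nullities is nonempty, and bounded by the number of vertices.) -/
noncomputable def nu [Finite α] (G : SignedGraph α β) : ℕ :=
  letI : Fintype V(G.graph) := Fintype.ofFinite _
  sSup G.nullities

/-! ### Signed subgraphs -/

/-- The signed graph formed by a set `F` of edges of `G`: its vertices are the ends of the edges
in `F`, its edges are those in `F`, and its odd edges are the odd edges of `G` in `F`. -/
def ofEdges (G : SignedGraph α β) (F : Set β) : SignedGraph α β where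
  graph :=
    { vertexSet := {x | ∃ e ∈ F, G.graph.Inc e x}
      IsLink := fun e x y => e ∈ F ∧ G.graph.IsLink e x y
      isLink_symm := fun _ _ => ⟨fun _ _ h => ⟨h.1, h.2.symm⟩⟩
      eq_or_eq_of_isLink_of_isLink := fun _ _ _ _ _ h h' => h.2.left_eq_or_eq h'.2
      left_mem_of_isLink := fun e _ y h => ⟨e, h.1, y, h.2⟩ }
  loopless := by
    have := G.loopless
    exact ⟨fun e x h => G.graph.not_isLoopAt e x h.2⟩
  odd := F ∩ G.odd
  odd_subset := by
    rintro e ⟨he, ho⟩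
    obtain ⟨x, y, h⟩ := Graph.exists_isLink_of_mem_edgeSet (G.odd_subset ho)
    exact ⟨x, y, he, h⟩

/-- `H` is (isomorphic to) a signed subgraph of `K`. -/
def IsSignedSubgraphOf (H : SignedGraph α β) (K : SignedGraph α' β') : Prop :=
  ∃ (f : α → α') (g : β → β'),
    Set.InjOn f V(H.graph) ∧ Set.InjOn g E(H.graph) ∧
    Set.MapsTo f V(H.graph) V(K.graph) ∧
    (∀ e x y, H.graph.IsLink e x y → K.graph.IsLink (g e) (f x) (f y)) ∧
    ∀ e ∈ E(H.graph), (e ∈ H.odd ↔ g e ∈ K.odd)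

/-- `K₂⁼`: two vertices joined by one odd edge (`true`) and one even edge (`false`). -/
def doubledK2 : SignedGraph Bool Bool where
  graph := Graph.banana false true Set.univ
  loopless := ⟨fun _ _ h => by simp at h⟩
  odd := {true}
  odd_subset := by simp

/-- Add new edges between the distinct vertices `u` and `v` of `H`: the odd edge `Sum.inr true` if
`true ∈ T`, and the even edge `Sum.inr false` if `false ∈ T`. -/
def addEdges (H : SignedGraph α β) (u v : α) (huv : u ≠ v) (hu : u ∈ V(H.graph))
    (hv : v ∈ V(H.graph)) (T : Set Bool) : SignedGraph α (β ⊕ Bool) where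
  graph :=
    { vertexSet := V(H.graph)
      IsLink := fun e x y =>
        match e with
        | Sum.inl e => H.graph.IsLink e x y
        | Sum.inr b => b ∈ T ∧ ((x = u ∧ y = v) ∨ (x = v ∧ y = u))
      isLink_symm := by
        rintro (e | b) _
        · exact ⟨fun _ _ h => h.symm⟩
        · exact ⟨fun _ _ h => ⟨h.1, h.2.symm.imp And.symm And.symm⟩⟩
      eq_or_eq_of_isLink_of_isLink := by
        rintro (e | b) x y z w h h'
        · exact Graph.IsLink.left_eq_or_eq h h'
        · grind
      left_mem_of_isLink := by
        rintro (e | b) x y h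
        · exact Graph.IsLink.left_mem h
        · rcases h with ⟨_, ⟨rfl, _⟩ | ⟨rfl, _⟩⟩ <;> assumption }
  loopless := by
    have := H.loopless
    refine ⟨?_⟩
    rintro (e | b) x h
    · exact H.graph.not_isLoopAt e x h
    · rcases h with ⟨_, ⟨h1, h2⟩ | ⟨h1, h2⟩⟩
      · exact huv (h1.symm.trans h2)
      · exact huv (h2.symm.trans h1)
  odd := Sum.inl '' H.odd ∪ Sum.inr '' (T ∩ {true})
  odd_subset := by
    rintro _ (⟨e, he, rfl⟩ | ⟨b, ⟨hb, _⟩, rfl⟩)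
    · exact Graph.exists_isLink_of_mem_edgeSet (H.odd_subset he)
    · exact ⟨u, v, hb, Or.inl ⟨rfl, rfl⟩⟩

/-! ### Splits -/

/-- A partition of the edge set of `G` into two nonempty classes. -/
structure EdgePartition (G : SignedGraph α β) where
  E₁ : Set β
  E₂ : Set β
  nonempty₁ : E₁.Nonempty
  nonempty₂ : E₂.Nonempty
  disjoint : Disjoint E₁ E₂
  union_eq : E₁ ∪ E₂ = E(G.graph)

namespace EdgePartition

variable {G : SignedGraph α β}

/-- The signed graph `(V₁, E₁)`, `E₁ ∩ Σ`. -/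
def side₁ (S : EdgePartition G) : SignedGraph α β := G.ofEdges S.E₁

/-- The signed graph `(V₂, E₂)`, `E₂ ∩ Σ`. -/
def side₂ (S : EdgePartition G) : SignedGraph α β := G.ofEdges S.E₂

/-- The set `V₁ ∩ V₂`. -/
def common (S : EdgePartition G) : Set α := V(S.side₁.graph) ∩ V(S.side₂.graph)

end EdgePartition

/-- For `k ≤ 1`: `G₁` and `G₂` form a `k`-split of `G`. -/
def FormSplit (k : ℕ) (G G₁ G₂ : SignedGraph α β) : Prop :=
  k ≤ 1 ∧ ∃ S : EdgePartition G, S.common.encard = k ∧ G₁ = S.side₁ ∧ G₂ = S.side₂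

/-- The data of a `2`-split of `G`; its parts are `part₁` and `part₂` below. -/
structure TwoSplit (G : SignedGraph α β) extends EdgePartition G where
  u : α
  v : α
  ne : u ≠ v
  common_eq : toEdgePartition.common = {u, v}
  connected₁ : toEdgePartition.side₁.IsConnected
  connected₂ : toEdgePartition.side₂.IsConnected
  not_sub₁ : ¬ toEdgePartition.side₁.IsSignedSubgraphOf doubledK2
  not_sub₂ : ¬ toEdgePartition.side₂.IsSignedSubgraphOf doubledK2

/-- The signs (`true` for odd) of the edges by which the side `K` is replaced: both signs if `K`
is not bipartite; if `K` is bipartite a single one, which is odd if and only if `K` has an odd path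
between `u` and `v`. -/
def replacementSigns (K : SignedGraph α β) (u v : α) : Set Bool :=
  {b | ¬ K.IsBipartite ∨ (b = true ↔ K.HasOddPath u v)}

namespace TwoSplit

variable {G : SignedGraph α β}

lemma u_mem (S : TwoSplit G) : S.u ∈ S.toEdgePartition.common := by simp [S.common_eq]

lemma v_mem (S : TwoSplit G) : S.v ∈ S.toEdgePartition.common := by simp [S.common_eq]

/-- The part `(G₁, Σ₁)` of a `2`-split: the second side is replaced by edges between `u`, `v`. -/
def part₁ (S : TwoSplit G) : SignedGraph α (β ⊕ Bool) :=
  S.side₁.addEdges S.u S.v S.ne S.u_mem.1 S.v_mem.1 (S.side₂.replacementSigns S.u S.v)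

/-- The part `(G₂, Σ₂)` of a `2`-split: the first side is replaced by edges between `u`, `v`. -/
def part₂ (S : TwoSplit G) : SignedGraph α (β ⊕ Bool) :=
  S.side₂.addEdges S.u S.v S.ne S.u_mem.2 S.v_mem.2 (S.side₁.replacementSigns S.u S.v)

end TwoSplit

end SignedGraph

/-! The sets of nullities attained on $G$, $G_1$, $G_2$ satisfy "set for $G$ = union of the other
two" (`EdgePartition.isNullity_iff`, `TwoSplit.isNullity_iff`), which gives the maximum. The tool is
the Schur complement: eliminating a positive definite block on $V(G)\setminus V_1$ preserves
semidefiniteness and nullity, and changes only entries between vertices of $V_1\cap V_2$, by the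
amount `fill`.

From $G$ to a part: if the blocks off $V_1$ and off $V_2$ were both singular, there would be kernel
vectors $x,y$ supported there, and $xy^T+yx^T$ would contradict the SAP (`Realizes.posDef_or`). The
only exception is nullity 1, which every nonempty graph attains (`isNullity_one`). So one block can
be eliminated (`isNullity_reduce`). In a 2-split the replacement edges record what is known about
the sign of the new entry $u,v$: a connected bipartite side can be switched to be all even, and
positive definite matrices with nonpositive off-diagonal entries have nonnegative inverses, so
`fill` has the sign of the replacement edge (`TwoSplit.fill_sign`). Otherwise both signs are added
and nothing is required.

From a part to $G$: attach weights with a positive definite block on the remaining vertices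
(`isNullity_extend`). With at most one common vertex any such gadget works. In a 2-split `fill` must
correct the entry $u,v$ to the sign demanded by $G$. A $u$–$v$ path avoiding direct edges gives
`fill` a definite sign, scaling adjusts its size, and the value 0 comes from the intermediate value
theorem (`exists_gadget_fill_eq`). The SAP could fail only because $u,v$ may be adjacent in the part
but not in $G$; then the condition `Nondegenerate` is needed, and `exists_nondegenerate` secures it
when `fill` is 0. -/

namespace SignedGraph

open Matrix

/-! ### Schur complements -/

section Schur

variable {N W : Type*} [Fintype W] [DecidableEq W]

/-- Eliminating an invertible diagonal block does not change the nullity. -/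
theorem finrank_ker_fromBlocks [Fintype N] (A : Matrix N N ℝ) (B : Matrix N W ℝ) (C : Matrix W N ℝ)
    {D : Matrix W W ℝ} (hD : IsUnit D.det) :
    Module.finrank ℝ (LinearMap.ker (fromBlocks A B C D).mulVecLin) =
      Module.finrank ℝ (LinearMap.ker (A - B * D⁻¹ * C).mulVecLin) := by
  have key : ∀ x : N ⊕ W → ℝ, fromBlocks A B C D *ᵥ x = 0 ↔
      x ∘ Sum.inr = -(D⁻¹ * C) *ᵥ (x ∘ Sum.inl) ∧ (A - B * D⁻¹ * C) *ᵥ (x ∘ Sum.inl) = 0 := by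
    intro x
    have h0 : fromBlocks A B C D *ᵥ x = 0 ↔ A *ᵥ (x ∘ Sum.inl) + B *ᵥ (x ∘ Sum.inr) = 0 ∧
        C *ᵥ (x ∘ Sum.inl) + D *ᵥ (x ∘ Sum.inr) = 0 := by
      rw [fromBlocks_mulVec, funext_iff, Sum.forall, funext_iff, funext_iff]
      rfl
    have h1 : C *ᵥ (x ∘ Sum.inl) + D *ᵥ (x ∘ Sum.inr) = 0 ↔
        x ∘ Sum.inr = -(D⁻¹ * C) *ᵥ (x ∘ Sum.inl) := by
      constructor
      · intro h
        have := congrArg (D⁻¹ *ᵥ ·) h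
        simp only [mulVec_add, mulVec_mulVec, nonsing_inv_mul _ hD, one_mulVec, mulVec_zero] at this
        rw [neg_mulVec]
        exact eq_neg_of_add_eq_zero_right this
      · intro h
        rw [h, mulVec_mulVec, Matrix.mul_neg, ← Matrix.mul_assoc, mul_nonsing_inv _ hD,
          Matrix.one_mul, neg_mulVec,
          add_neg_cancel]
    rw [h0, h1, and_comm]
    refine and_congr_right fun h => ?_
    rw [h, mulVec_mulVec, Matrix.mul_neg, ← Matrix.mul_assoc, neg_mulVec, sub_mulVec, sub_eq_add_neg]
  let f : (N ⊕ W → ℝ) →ₗ[ℝ] (N → ℝ) := LinearMap.funLeft ℝ ℝ Sum.inl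
  have hf : ∀ x ∈ LinearMap.ker (fromBlocks A B C D).mulVecLin,
      f x ∈ LinearMap.ker (A - B * D⁻¹ * C).mulVecLin := by
    intro x hx
    rw [LinearMap.mem_ker, mulVecLin_apply] at hx ⊢
    exact ((key x).1 hx).2
  refine LinearEquiv.finrank_eq (LinearEquiv.ofBijective (f.restrict hf) ⟨?_, ?_⟩)
  · rw [← LinearMap.ker_eq_bot, LinearMap.ker_eq_bot']
    rintro ⟨x, hx⟩ h
    have h' : x ∘ Sum.inl = 0 := congrArg Subtype.val h
    rw [LinearMap.mem_ker, mulVecLin_apply, key, h', mulVec_zero] at hx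
    ext i
    rcases i with i | i
    · exact congrFun h' i
    · exact congrFun hx.1 i
  · rintro ⟨y, hy⟩
    rw [LinearMap.mem_ker, mulVecLin_apply] at hy
    refine ⟨⟨Sum.elim y (-(D⁻¹ * C) *ᵥ y), ?_⟩, ?_⟩
    · rw [LinearMap.mem_ker, mulVecLin_apply, key]
      exact ⟨by simp, by simpa using hy⟩
    · ext i; rfl

theorem mul_left_cancel_of_isUnit_det {D : Matrix W W ℝ} (hD : IsUnit D.det) {Q R : Matrix W N ℝ}
    (h : D * Q = D * R) : Q = R := by
  have := congrArg (D⁻¹ * ·) h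
  simpa only [← Matrix.mul_assoc, nonsing_inv_mul _ hD, Matrix.one_mul] using this

/-- The symmetric matrices annihilated by a block matrix with invertible corner `D` are
determined by their first block. -/
theorem fromBlocks_mul_eq_zero_iff [Fintype N] (A : Matrix N N ℝ) (B : Matrix N W ℝ) {D : Matrix W W ℝ}
    (hD : IsUnit D.det) {P : Matrix W N ℝ} (hP : D * P = -Bᵀ)
    {Y : Matrix N N ℝ} {Z : Matrix N W ℝ} {U : Matrix W W ℝ} (hY : Y.IsSymm) :
    fromBlocks A B Bᵀ D * fromBlocks Y Z Zᵀ U = 0 ↔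
      (A + B * P) * Y = 0 ∧ Z = Y * Pᵀ ∧ U = P * Y * Pᵀ := by
  have hB : Bᵀ = -(D * P) := by rw [hP, neg_neg]
  rw [fromBlocks_multiply, ← fromBlocks_zero, fromBlocks_inj]
  constructor
  -- The lower blocks give $Z^T=PY$ and $U=PZ$; the upper right block is then automatic.
  · rintro ⟨h1, -, h3, h4⟩
    have hZt : Zᵀ = P * Y := by
      apply mul_left_cancel_of_isUnit_det hD
      rw [hB, Matrix.neg_mul] at h3
      rw [← Matrix.mul_assoc]
      exact (eq_of_neg_add_eq_zero h3).symm
    have hZ : Z = Y * Pᵀ := by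
      rw [← transpose_transpose Z, hZt, transpose_mul, hY.eq]
    refine ⟨?_, hZ, ?_⟩
    · rw [hZt] at h1
      rw [Matrix.add_mul, Matrix.mul_assoc]; exact h1
    · apply mul_left_cancel_of_isUnit_det hD
      rw [hB, Matrix.neg_mul] at h4
      rw [Matrix.mul_assoc P, ← hZ, ← Matrix.mul_assoc]
      exact (eq_of_neg_add_eq_zero h4).symm
  · rintro ⟨h1, hZ, hU⟩
    have hZt : Zᵀ = P * Y := by rw [hZ, transpose_mul, transpose_transpose, hY.eq]
    have h1' : A * Y + B * (P * Y) = 0 := by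
      rw [← Matrix.mul_assoc, ← Matrix.add_mul]; exact h1
    refine ⟨?_, ?_, ?_, ?_⟩
    · rw [hZt]; exact h1'
    · rw [hU, hZ, Matrix.mul_assoc P, ← Matrix.mul_assoc A, ← Matrix.mul_assoc B P,
        ← Matrix.mul_assoc (B * P), ← Matrix.add_mul, Matrix.mul_assoc B, h1', Matrix.zero_mul]
    · rw [hZt, hB, Matrix.neg_mul, Matrix.mul_assoc, neg_add_cancel]
    · rw [hB, hU, hZ, Matrix.neg_mul, Matrix.mul_assoc P, Matrix.mul_assoc D, neg_add_cancel]

end Schur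

/-! ### Realizations of sign patterns -/

/-- The off-diagonal entries of `A` obey the signs prescribed by the even and odd adjacencies. -/
def SignPattern {V : Type*} (ev od : V → V → Prop) (A : V → V → ℝ) : Prop :=
  ∀ i j, i ≠ j → (ev i j → ¬ od i j → A i j < 0) ∧ (od i j → ¬ ev i j → 0 < A i j) ∧
    (¬ (ev i j ∨ od i j) → A i j = 0)

/-- `A` is a positive semidefinite matrix of nullity `k` with the Strong Arnold Property for the
sign pattern given by `ev` and `od`. -/
structure Realizes {V : Type*} [Fintype V] (ev od : V → V → Prop) (A : Matrix V V ℝ) (k : ℕ) :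
    Prop where
  isSymm : A.IsSymm
  pattern : SignPattern ev od A
  posSemidef : A.PosSemidef
  sap : ∀ X : Matrix V V ℝ, X.IsSymm → (∀ i j, ((ev i j ∨ od i j) ∨ i = j) → X i j = 0) →
    A * X = 0 → X = 0
  nullity : Module.finrank ℝ (LinearMap.ker A.mulVecLin) = k

theorem Realizes.submatrix {V V' : Type*} [Fintype V] [Fintype V'] {ev od : V → V → Prop}
    {A : Matrix V V ℝ} {k : ℕ} (h : Realizes ev od A k) (e : V' ≃ V) :
    Realizes (fun i j => ev (e i) (e j)) (fun i j => od (e i) (e j)) (A.submatrix e e) k where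
  isSymm := h.isSymm.submatrix e
  pattern i j hij := h.pattern (e i) (e j) (e.injective.ne hij)
  posSemidef := h.posSemidef.submatrix e
  sap X hX hz hAX := by
    have := h.sap (X.submatrix e.symm e.symm) (hX.submatrix _) (fun i j hij => hz _ _ (by
      simpa using hij)) (by
        have := congrArg (fun M => Matrix.submatrix M e.symm e.symm) hAX
        simpa [← submatrix_mul_equiv _ _ e.symm e.symm e.symm] using this)
    ext i j
    simpa using congrFun (congrFun this (e i)) (e j)
  nullity := by
    rw [← h.nullity]
    have h1 := (A.submatrix e e).mulVecLin.finrank_range_add_finrank_ker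
    have h2 := A.mulVecLin.finrank_range_add_finrank_ker
    have h3 := rank_submatrix A e e
    rw [rank, rank] at h3
    rw [Module.finrank_pi] at h1 h2
    have := Fintype.card_congr e
    omega

/-- Schur complementation keeps the realization property, provided the terminals (the kept
vertices that meet eliminated ones) are pairwise adjacent in the new pattern. -/
theorem Realizes.schur {N W : Type*} [Fintype N] [Fintype W] [DecidableEq N] [DecidableEq W]
    {ev od : N ⊕ W → N ⊕ W → Prop} {ev' od' : N → N → Prop} {k : ℕ}
    {A : Matrix N N ℝ} {B : Matrix N W ℝ} {D : Matrix W W ℝ}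
    (h : Realizes ev od (fromBlocks A B Bᵀ D) k) (hD : D.PosDef) (τ : N → Prop)
    (hτ : ∀ n w, ¬ τ n → ¬ (ev (.inl n) (.inr w) ∨ od (.inl n) (.inr w)))
    (hτ' : ∀ n w, ¬ τ n → ¬ (ev (.inr w) (.inl n) ∨ od (.inr w) (.inl n)))
    (hclique : ∀ n n', τ n → τ n' → (ev' n n' ∨ od' n n') ∨ n = n')
    (hadj : ∀ n n', ev (.inl n) (.inl n') ∨ od (.inl n) (.inl n') → ev' n n' ∨ od' n n')
    (hpat : SignPattern ev' od' (A - B * D⁻¹ * Bᵀ)) :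
    Realizes ev' od' (A - B * D⁻¹ * Bᵀ) k := by
  have hdet : IsUnit D.det := (isUnit_iff_isUnit_det D).1 hD.isUnit
  have hDs : Dᵀ = D := by simpa [conjTranspose_eq_transpose_of_trivial] using hD.isHermitian.eq
  have hAs : Aᵀ = A := by
    have := h.isSymm.eq
    rw [fromBlocks_transpose, fromBlocks_inj] at this
    exact this.1
  have hBz : ∀ n w, ¬ τ n → B n w = 0 := fun n w hn =>
    (h.pattern (.inl n) (.inr w) (by simp)).2.2 (hτ n w hn)
  set P : Matrix W N ℝ := -(D⁻¹ * Bᵀ) with hPdef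
  have hP : D * P = -Bᵀ := by
    rw [hPdef, Matrix.mul_neg, ← Matrix.mul_assoc, mul_nonsing_inv _ hdet, Matrix.one_mul]
  have hPz : ∀ n w, ¬ τ n → P w n = 0 := by
    intro n w hn
    rw [hPdef, Matrix.neg_apply, mul_apply, neg_eq_zero]
    exact Finset.sum_eq_zero fun w' _ => by rw [transpose_apply, hBz n w' hn, mul_zero]
  have hS : A - B * D⁻¹ * Bᵀ = A + B * P := by
    rw [hPdef, Matrix.mul_neg, ← Matrix.mul_assoc, sub_eq_add_neg]
  refine ⟨?_, hpat, ?_, ?_, ?_⟩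
  · unfold IsSymm
    rw [transpose_sub, transpose_mul, transpose_mul, transpose_transpose, transpose_nonsing_inv,
      hDs, hAs, Matrix.mul_assoc]
  · let := D.invertibleOfIsUnitDet hdet
    have := (PosDef.fromBlocks₂₂ A B hD).1 (by
      simpa [conjTranspose_eq_transpose_of_trivial] using h.posSemidef)
    simpa [conjTranspose_eq_transpose_of_trivial] using this
  · intro Y hY hz hSY
    have hYt : ∀ n n', τ n → τ n' → Y n n' = 0 := fun n n' hn hn' => hz n n' (hclique n n' hn hn')
    -- $Y$ vanishes between terminals and $P$ vanishes off terminals, so every product in the sum is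
    -- zero. This is where the terminals must form a clique in the new pattern.
    have hZ : ∀ n w, τ n → (Y * Pᵀ) n w = 0 := by
      intro n w hn
      rw [mul_apply]
      refine Finset.sum_eq_zero fun n' _ => ?_
      by_cases hn' : τ n'
      · rw [hYt n n' hn hn', zero_mul]
      · rw [transpose_apply, hPz n' w hn', mul_zero]
    have hU : P * Y * Pᵀ = 0 := by
      ext w w'
      rw [Matrix.mul_assoc, mul_apply]
      refine Finset.sum_eq_zero fun n _ => ?_
      by_cases hn : τ n
      · rw [hZ n w' hn, mul_zero]
      · rw [hPz n w hn, zero_mul]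
    -- The unique lift of $Y$ to a matrix annihilated by the full block matrix; the vanishing of its
    -- blocks on adjacent pairs makes it admissible.
    have hX := h.sap (fromBlocks Y (Y * Pᵀ) (Y * Pᵀ)ᵀ (P * Y * Pᵀ)) ?_ ?_ ?_
    · rw [← fromBlocks_zero, fromBlocks_inj] at hX
      exact hX.1
    · refine IsSymm.fromBlocks hY (by simp) ?_
      rw [hU]; exact isSymm_zero
    · rintro (n | w) (n' | w') hij
      · rcases hij with hij | hij
        · exact hz n n' (Or.inl (hadj n n' hij))
        · exact hz n n' (Or.inr (Sum.inl_injective hij))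
      · rw [fromBlocks_apply₁₂]
        by_cases hn : τ n
        · exact hZ n w' hn
        · rcases hij with hij | hij
          · exact absurd hij (hτ n w' hn)
          · simp at hij
      · rw [fromBlocks_apply₂₁, transpose_apply]
        by_cases hn : τ n'
        · exact hZ n' w hn
        · rcases hij with hij | hij
          · exact absurd hij (hτ' n' w hn)
          · simp at hij
      · rw [fromBlocks_apply₂₂, hU]; rfl
    · rw [fromBlocks_mul_eq_zero_iff A B hdet hP hY, ← hS]
      exact ⟨hSY, rfl, rfl⟩
  · rw [← finrank_ker_fromBlocks A B Bᵀ hdet]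
    exact h.nullity

/-- A realization is extended by vertices whose diagonal block is positive definite. -/
theorem Realizes.extend {N W : Type*} [Fintype N] [Fintype W] [DecidableEq N] [DecidableEq W]
    {ev od : N ⊕ W → N ⊕ W → Prop} {ev' od' : N → N → Prop} {k : ℕ}
    {S : Matrix N N ℝ} {B : Matrix N W ℝ} {D : Matrix W W ℝ}
    (h : Realizes ev' od' S k) (hD : D.PosDef)
    (hpat : SignPattern ev od (fromBlocks (S + B * D⁻¹ * Bᵀ) B Bᵀ D))
    (hext : ∀ (Y : Matrix N N ℝ) (P : Matrix W N ℝ), D * P = -Bᵀ → Y.IsSymm →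
      (∀ n n', ((ev (.inl n) (.inl n') ∨ od (.inl n) (.inl n')) ∨ n = n') → Y n n' = 0) →
      (∀ n w, (ev (.inl n) (.inr w) ∨ od (.inl n) (.inr w)) → (Y * Pᵀ) n w = 0) →
      (∀ w w', ((ev (.inr w) (.inr w') ∨ od (.inr w) (.inr w')) ∨ w = w') →
        (P * Y * Pᵀ) w w' = 0) →
      ∀ n n', (ev' n n' ∨ od' n n') → Y n n' = 0) :
    Realizes ev od (fromBlocks (S + B * D⁻¹ * Bᵀ) B Bᵀ D) k := by
  have hdet : IsUnit D.det := (isUnit_iff_isUnit_det D).1 hD.isUnit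
  have hDs : Dᵀ = D := by simpa [conjTranspose_eq_transpose_of_trivial] using hD.isHermitian.eq
  have hSs := h.isSymm.eq
  set P : Matrix W N ℝ := -(D⁻¹ * Bᵀ) with hPdef
  have hP : D * P = -Bᵀ := by
    rw [hPdef, Matrix.mul_neg, ← Matrix.mul_assoc, mul_nonsing_inv _ hdet, Matrix.one_mul]
  have hS : S + B * D⁻¹ * Bᵀ + B * P = S := by
    rw [hPdef, Matrix.mul_neg, ← Matrix.mul_assoc, add_neg_cancel_right]
  refine ⟨?_, hpat, ?_, ?_, ?_⟩
  · refine IsSymm.fromBlocks ?_ rfl hDs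
    unfold IsSymm
    rw [transpose_add, transpose_mul, transpose_mul, transpose_transpose, transpose_nonsing_inv,
      hDs, hSs, Matrix.mul_assoc]
  · let := D.invertibleOfIsUnitDet hdet
    have := (PosDef.fromBlocks₂₂ (S + B * D⁻¹ * Bᵀ) B hD).2 (by
      simpa [conjTranspose_eq_transpose_of_trivial] using h.posSemidef)
    simpa [conjTranspose_eq_transpose_of_trivial] using this
  · intro X hX hz hAX
    obtain ⟨Y, Z, Z', U, rfl⟩ : ∃ Y Z Z' U, X = fromBlocks Y Z Z' U :=
      ⟨_, _, _, _, (fromBlocks_toBlocks X).symm⟩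
    rw [isSymm_fromBlocks_iff] at hX
    obtain ⟨hY, rfl, -, -⟩ := hX
    rw [fromBlocks_mul_eq_zero_iff _ B hdet hP hY, hS] at hAX
    obtain ⟨h1, rfl, rfl⟩ := hAX
    -- The Schur complement is $S$ again. `hext` supplies the zeros of $Y$ at pairs adjacent in the
    -- old pattern, which the new pattern need not contain.
    have hY0 : Y = 0 := by
      refine h.sap Y hY ?_ h1
      rintro n n' (hn | rfl)
      · refine hext Y P hP hY ?_ ?_ ?_ n n' hn
        · intro i j hij
          exact hz (.inl i) (.inl j) (hij.imp_right (congrArg _))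
        · intro i j hij
          exact hz (.inl i) (.inr j) (.inl hij)
        · intro i j hij
          exact hz (.inr i) (.inr j) (hij.imp_right (congrArg _))
      · exact hz (.inl n) (.inl n) (.inr rfl)
    subst hY0
    simp
  · rw [finrank_ker_fromBlocks _ B Bᵀ hdet, add_sub_cancel_right]
    exact h.nullity

end SignedGraph

namespace SignedGraph

variable {α β : Type*}

/-! ### Walks -/

namespace Walk

variable {G : SignedGraph α β}

/-- Concatenation of walks. -/
def append : {x y z : α} → Walk G x y → Walk G y z → Walk G x z
  | _, _, _, nil _ _, q => q
  | _, _, _, cons e h p, q => cons e h (p.append q)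

theorem edges_append {x y z : α} (p : Walk G x y) (q : Walk G y z) :
    (p.append q).edges = p.edges ++ q.edges := by
  induction p with
  | nil => rfl
  | cons e h p ih => simp [append, edges, ih]

theorem left_mem {x y : α} (p : Walk G x y) : x ∈ V(G.graph) := by
  cases p with
  | nil _ hx => exact hx
  | cons e h p => exact h.left_mem

theorem right_mem {x y : α} (p : Walk G x y) : y ∈ V(G.graph) := by
  induction p with
  | nil _ hx => exact hx
  | cons e h p ih => exact ih

theorem start_mem_support {x y : α} (p : Walk G x y) : x ∈ p.support := by
  cases p <;> simp [support]

theorem end_mem_support {x y : α} (p : Walk G x y) : y ∈ p.support := by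
  induction p <;> simp_all [support]

theorem mem_vertexSet_of_mem_support {x y z : α} (p : Walk G x y) (hz : z ∈ p.support) :
    z ∈ V(G.graph) := by
  induction p with
  | nil x hx => simp [support] at hz; exact hz ▸ hx
  | cons e h p ih =>
    simp only [support, List.mem_cons] at hz
    rcases hz with rfl | hz
    · exact h.left_mem
    · exact ih hz

theorem exists_reverse {x y : α} (p : Walk G x y) : ∃ q : Walk G y x, q.edges.Perm p.edges := by
  induction p with
  | nil x hx => exact ⟨nil x hx, List.Perm.refl _⟩
  | @cons x y z e h p ih =>
    obtain ⟨q, hq⟩ := ih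
    refine ⟨q.append (cons e h.symm (nil x h.left_mem)), ?_⟩
    rw [edges_append]
    simp only [edges]
    exact (List.perm_append_comm).trans (by simpa using hq)

theorem oddCount_perm {x y x' y' : α} {p : Walk G x y} {q : Walk G x' y'}
    (h : p.edges.Perm q.edges) : p.oddCount = q.oddCount := h.countP_eq _

theorem oddCount_append {x y z : α} (p : Walk G x y) (q : Walk G y z) :
    (p.append q).oddCount = p.oddCount + q.oddCount := by
  unfold oddCount
  rw [edges_append, List.countP_append]

open Classical in
theorem oddCount_cons {x y z : α} (e : β) (h : G.graph.IsLink e x y) (p : Walk G y z) :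
    (cons e h p).oddCount = p.oddCount + if e ∈ G.odd then 1 else 0 := by
  unfold oddCount
  simp [edges, List.countP_cons]

theorem mem_support_of_isLink {x y z w : α} {e : β} (p : Walk G x y) (he : e ∈ p.edges)
    (h : G.graph.IsLink e z w) : z ∈ p.support := by
  induction p with
  | nil => simp [edges] at he
  | cons e' h' p ih =>
    simp only [edges, List.mem_cons] at he
    simp only [support, List.mem_cons]
    rcases he with rfl | he
    · rcases h.left_eq_or_eq h' with rfl | rfl
      · exact Or.inl rfl
      · exact Or.inr p.start_mem_support
    · exact Or.inr (ih he)

theorem exists_append_of_mem_support {x y z : α} (p : Walk G x y) (hz : z ∈ p.support) :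
    ∃ (q : Walk G x z) (r : Walk G z y), p.edges = q.edges ++ r.edges := by
  induction p with
  | nil x hx =>
    simp only [support, List.mem_singleton] at hz
    subst hz
    exact ⟨nil z hx, nil z hx, rfl⟩
  | @cons x y w e h p ih =>
    simp only [support, List.mem_cons] at hz
    rcases hz with rfl | hz
    · exact ⟨nil _ h.left_mem, cons e h p, rfl⟩
    · obtain ⟨q, r, h1⟩ := ih hz
      exact ⟨cons e h q, r, by simp [edges, h1]⟩

/-- A walk that is not a path passes through a nontrivial closed walk. -/
theorem exists_closed_of_not_isPath {x y : α} (p : Walk G x y) (hp : ¬ p.IsPath) :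
    ∃ (z : α) (q : Walk G x z) (c : Walk G z z) (r : Walk G z y),
      p.edges = q.edges ++ c.edges ++ r.edges ∧ c.edges ≠ [] := by
  induction p with
  | nil x hx => simp [IsPath, support] at hp
  | @cons x y w e h p ih =>
    by_cases hx : x ∈ p.support
    · obtain ⟨q, r, h1⟩ := p.exists_append_of_mem_support hx
      exact ⟨x, nil x h.left_mem, cons e h q, r, by simp [edges, h1], by simp [edges]⟩
    · obtain ⟨z, q, c, r, h1, h2⟩ := ih (fun hp' => hp (by
        simp only [IsPath, support, List.nodup_cons]; exact ⟨hx, hp'⟩))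
      exact ⟨z, cons e h q, c, r, by simp [edges, h1], h2⟩

/-- Cutting out a nontrivial closed subwalk shortens the walk and keeps its ends. -/
theorem exists_isPath {x y : α} (p : Walk G x y) : ∃ q : Walk G x y, q.IsPath := by
  obtain ⟨n, hn⟩ : ∃ n, p.edges.length = n := ⟨_, rfl⟩
  induction n using Nat.strong_induction_on generalizing p with
  | _ n ih =>
    by_cases hp : p.IsPath
    · exact ⟨p, hp⟩
    · obtain ⟨z, q, c, r, h1, h2⟩ := p.exists_closed_of_not_isPath hp
      refine ih _ ?_ (q.append r) rfl
      have := List.length_pos_iff.2 h2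
      simp only [edges_append, ← hn, h1, List.length_append]
      omega

theorem IsPath.edges_nodup {x y : α} {p : Walk G x y} (hp : p.IsPath) : p.edges.Nodup := by
  induction p with
  | nil => simp [edges]
  | cons e h p ih =>
    simp only [IsPath, support, List.nodup_cons] at hp
    simp only [edges, List.nodup_cons]
    exact ⟨fun he => hp.1 (p.mem_support_of_isLink he h), ih hp.2⟩

theorem IsPath.edges_eq_nil {x : α} {p : Walk G x x} (hp : p.IsPath) : p.edges = [] := by
  cases p with
  | nil => rfl
  | cons e h p =>
    simp only [IsPath, support, List.nodup_cons] at hp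
    exact absurd p.end_mem_support hp.1

/-- The edge meets the initial vertex, so it comes first; it already reaches the final vertex, where
the path must stop. -/
theorem IsPath.edges_eq_singleton {x y : α} {p : Walk G y x} {e : β} (hp : p.IsPath)
    (he : e ∈ p.edges) (h : G.graph.IsLink e x y) : p.edges = [e] := by
  cases p with
  | nil => simp [edges] at he
  | cons e' h' p =>
    simp only [IsPath, support, List.nodup_cons] at hp
    simp only [edges, List.mem_cons] at he
    rcases he with rfl | he
    · obtain rfl := h.symm.right_unique h'
      simp only [edges]
      rw [IsPath.edges_eq_nil hp.2]
    · exact absurd (p.mem_support_of_isLink he h.symm) hp.1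

/-- A signed graph with an odd closed walk has an odd cycle. -/
theorem exists_odd_cycle {x : α} (p : Walk G x x) (hp : Odd p.oddCount) :
    ∃ (y : α) (c : Walk G y y), c.IsCycle ∧ Odd c.oddCount := by
  obtain ⟨n, hn⟩ : ∃ n, p.edges.length = n := ⟨_, rfl⟩
  induction n using Nat.strong_induction_on generalizing x p with
  | _ n ih =>
    cases p with
    | nil => simp [oddCount, edges] at hp
    | @cons _ y _ e h p =>
      by_cases hpath : p.IsPath
      · refine ⟨x, cons e h p, ⟨by simp [edges], ?_, hpath⟩, hp⟩
        simp only [edges, List.nodup_cons]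
        -- If the first edge recurs, the closed walk traverses just this edge twice, and its count
        -- is even.
        refine ⟨fun he => ?_, hpath.edges_nodup⟩
        have h1 := hpath.edges_eq_singleton he h
        classical
        rw [oddCount_cons, oddCount, h1] at hp
        by_cases ho : e ∈ G.odd <;> simp [ho] at hp
        exact absurd hp (by decide)
      · obtain ⟨z, q, c, r, h1, h2⟩ := p.exists_closed_of_not_isPath hpath
        have h3 := List.length_pos_iff.2 h2
        simp only [edges, List.length_cons, h1, List.length_append] at hn
        -- Of the closed subwalk and the rest, exactly one is odd, and both are shorter.
        by_cases hc : Odd c.oddCount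
        · exact ih _ (by omega) c hc rfl
        · refine ih (cons e h (q.append r)).edges.length ?_ (cons e h (q.append r)) ?_ rfl
          · simp only [edges, edges_append, List.length_cons, List.length_append]
            omega
          · rw [oddCount_cons, oddCount_append]
            rw [oddCount_cons, oddCount, h1, List.countP_append, List.countP_append] at hp
            rw [Nat.not_odd_iff_even] at hc
            simp only [oddCount] at hc ⊢
            grind

end Walk

/-! ### Switching functions -/

open Classical in
/-- The sign of an edge: `-1` if it is odd, and `1` if it is even. -/
noncomputable def edgeSign (G : SignedGraph α β) (e : β) : ℝ := if e ∈ G.odd then -1 else 1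

variable {G : SignedGraph α β}

theorem edgeSign_of_odd {e : β} (h : e ∈ G.odd) : G.edgeSign e = -1 := if_pos h

theorem edgeSign_of_even {e : β} (h : e ∉ G.odd) : G.edgeSign e = 1 := if_neg h

theorem Walk.neg_one_pow_oddCount_cons {x y z : α} (e : β) (h : G.graph.IsLink e x y)
    (p : Walk G y z) : (-1 : ℝ) ^ (Walk.cons e h p).oddCount = G.edgeSign e * (-1) ^ p.oddCount := by
  classical
  rw [Walk.oddCount_cons, edgeSign]
  split_ifs <;> simp [pow_succ]

/-- Telescoping: in the product of the edge signs each inner value of `σ` is squared. -/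
theorem Walk.switching_eq {x y : α} (p : Walk G x y) {σ : α → ℝ} (hσ : ∀ z, σ z = 1 ∨ σ z = -1)
    (h : ∀ e ∈ p.edges, ∀ z w, G.graph.IsLink e z w → σ z * σ w = G.edgeSign e) :
    σ x * σ y = (-1) ^ p.oddCount := by
  induction p with
  | nil x hx => rcases hσ x with h | h <;> simp [h, Walk.oddCount, Walk.edges]
  | @cons x y z e hl p ih =>
    rw [Walk.neg_one_pow_oddCount_cons, ← h e (by simp [Walk.edges]) x y hl,
      ← ih fun e' he' => h e' (by simp [Walk.edges, he'])]
    rcases hσ y with hy | hy <;> rw [hy] <;> ring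

/-- The edges of a path can be switched to be even. -/
theorem Walk.IsPath.exists_switching {x y : α} {p : Walk G x y} (hp : p.IsPath) :
    ∃ σ : α → ℝ, (∀ z, σ z = 1 ∨ σ z = -1) ∧
      ∀ e ∈ p.edges, ∀ z w, G.graph.IsLink e z w → σ z * σ w = G.edgeSign e := by
  classical
  induction p with
  | nil => exact ⟨fun _ => 1, fun _ => Or.inl rfl, by simp [Walk.edges]⟩
  | @cons x y z e h p ih =>
    simp only [Walk.IsPath, Walk.support, List.nodup_cons] at hp
    obtain ⟨σ, h1, h2⟩ := ih hp.2
    have hxy : y ≠ x := fun hxy => hp.1 (hxy ▸ p.start_mem_support)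
    have hs : G.edgeSign e = 1 ∨ G.edgeSign e = -1 := by
      unfold edgeSign; split_ifs <;> simp
    -- The value at `x` is free, since no later edge of the path meets `x`.
    refine ⟨Function.update σ x (σ y * G.edgeSign e), fun z => ?_, fun e' he' a b hab => ?_⟩
    · by_cases hz : z = x
      · subst hz
        rw [Function.update_self]
        rcases h1 y with h | h <;> rcases hs with hs | hs <;> simp [h, hs]
      · rw [Function.update_of_ne hz]; exact h1 z
    · simp only [Walk.edges, List.mem_cons] at he'
      rcases he' with rfl | he'
      · have hy : σ y * σ y = 1 := by rcases h1 y with h | h <;> simp [h]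
        obtain ⟨rfl, rfl⟩ | ⟨rfl, rfl⟩ := hab.eq_and_eq_or_eq_and_eq h
        · rw [Function.update_self, Function.update_of_ne hxy]
          linear_combination G.edgeSign e' * hy
        · rw [Function.update_self, Function.update_of_ne hxy]
          linear_combination G.edgeSign e' * hy
      · have ha : a ≠ x := fun h => hp.1 (h ▸ p.mem_support_of_isLink he' hab)
        have hb : b ≠ x := fun h => hp.1 (h ▸ p.mem_support_of_isLink he' hab.symm)
        rw [Function.update_of_ne ha, Function.update_of_ne hb]
        exact h2 e' he' a b hab

/-- The edges of a connected bipartite signed graph can be switched to be even. -/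
theorem IsBipartite.exists_switching (hb : G.IsBipartite) (hc : G.IsConnected) :
    ∃ σ : α → ℝ, (∀ z, σ z = 1 ∨ σ z = -1) ∧
      ∀ e z w, G.graph.IsLink e z w → σ z * σ w = G.edgeSign e := by
  classical
  obtain ⟨⟨r, hr⟩, hw⟩ := hc
  let W : ∀ x, x ∈ V(G.graph) → Walk G r x := fun x hx => (hw r hr x hx).some
  -- The parity of a chosen walk from the root. An edge together with the walks to its ends closes
  -- up to an even walk, so the choice does not matter.
  let σ : α → ℝ := fun x => if hx : x ∈ V(G.graph) then (-1) ^ (W x hx).oddCount else 1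
  have h1 : ∀ z, σ z = 1 ∨ σ z = -1 := by
    intro z
    simp only [σ]
    split_ifs with hz
    · exact neg_one_pow_eq_or ℝ _
    · exact Or.inl rfl
  refine ⟨σ, h1, fun e z w h => ?_⟩
  obtain ⟨q, hq⟩ := (W w h.right_mem).exists_reverse
  have hcl : ¬ Odd ((W z h.left_mem).append (.cons e h q)).oddCount := fun ho => by
    obtain ⟨y, c, h2, h3⟩ := Walk.exists_odd_cycle _ ho
    exact hb y c h2 h3
  rw [Nat.not_odd_iff_even] at hcl
  have h4 := hcl.neg_one_pow (α := ℝ)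
  rw [Walk.oddCount_append, pow_add, Walk.neg_one_pow_oddCount_cons, Walk.oddCount_perm hq] at h4
  have hz : σ z = (-1) ^ (W z h.left_mem).oddCount := dif_pos h.left_mem
  have hw' : σ w = (-1) ^ (W w h.right_mem).oddCount := dif_pos h.right_mem
  rw [← hz, ← hw'] at h4
  have hs : G.edgeSign e = 1 ∨ G.edgeSign e = -1 := by
    unfold edgeSign; split_ifs <;> simp
  rcases h1 z with h5 | h5 <;> rcases h1 w with h6 | h6 <;> rcases hs with h7 | h7 <;>
    rw [h5, h6, h7] at h4 ⊢ <;> linarith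

end SignedGraph

namespace SignedGraph

open Matrix

variable {α β : Type*}

/-! ### Positive definite matrices with nonpositive off-diagonal entries -/

section ZMatrix

variable {ι : Type*} [Fintype ι] {D : Matrix ι ι ℝ} {b q : ι → ℝ}

/-- Test with the negative part $n$ of $q$. Since $n$ and $n+q$ are nonnegative with disjoint
supports, $n^TD(n+q)\le 0$, while $n^TDq=-n^Tb\ge 0$. Hence $n^TDn\le 0$ and $n=0$. -/
theorem nonneg_of_mulVec_eq_neg (hD : D.PosDef) (hz : ∀ i j, i ≠ j → D i j ≤ 0)
    (hq : D *ᵥ q = -b) (hb : ∀ i, b i ≤ 0) (i : ι) : 0 ≤ q i := by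
  let n : ι → ℝ := fun i => max (-q i) 0
  have hn : ∀ i, 0 ≤ n i := fun i => le_max_right _ _
  have hr : ∀ i, 0 ≤ n i + q i := fun i => by
    have := le_max_left (-q i) 0
    simp only [n]; linarith
  have h1 : 0 ≤ n ⬝ᵥ D *ᵥ q := by
    rw [hq]
    exact Finset.sum_nonneg fun i _ => mul_nonneg (hn i) (by simpa using hb i)
  have h2 : n ⬝ᵥ D *ᵥ (n + q) ≤ 0 := by
    refine Finset.sum_nonpos fun i _ => ?_
    rw [mulVec, dotProduct, Finset.mul_sum]
    refine Finset.sum_nonpos fun j _ => ?_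
    by_cases hij : i = j
    · subst hij
      have : n i * (n i + q i) = 0 := by
        simp only [n]
        rcases max_choice (-q i) 0 with h | h <;> rw [h] <;> ring
      simp only [Pi.add_apply]
      rw [mul_left_comm, this, mul_zero]
    · exact mul_nonpos_of_nonneg_of_nonpos (hn i)
        (mul_nonpos_of_nonpos_of_nonneg (hz i j hij) (hr j))
  have h3 : n = 0 := by
    by_contra h
    have := (posDef_iff_dotProduct_mulVec.1 hD).2 h
    rw [star_trivial] at this
    rw [mulVec_add, dotProduct_add] at h2
    linarith
  have h4 := hr i
  rw [h3] at h4
  simpa using h4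

/-- If $q_i=0$, row $i$ equates a sum of nonpositive terms with $-b_i\ge 0$; either alternative
makes this impossible. -/
theorem pos_of_mulVec_eq_neg (hD : D.PosDef) (hz : ∀ i j, i ≠ j → D i j ≤ 0)
    (hq : D *ᵥ q = -b) (hb : ∀ i, b i ≤ 0) {i : ι}
    (h : b i < 0 ∨ ∃ j, i ≠ j ∧ D i j < 0 ∧ 0 < q j) : 0 < q i := by
  have hnn := nonneg_of_mulVec_eq_neg hD hz hq hb
  refine lt_of_le_of_ne (hnn i) fun h0 => ?_
  have h1 : ∑ j, D i j * q j = - b i := congrFun hq i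
  have hle : ∀ j ∈ Finset.univ, D i j * q j ≤ 0 := fun j _ => by
    by_cases hij : i = j
    · subst hij; rw [← h0, mul_zero]
    · exact mul_nonpos_of_nonpos_of_nonneg (hz i j hij) (hnn j)
  rcases h with h | ⟨j, hij, h2, h3⟩
  · have := Finset.sum_nonpos hle
    linarith
  · have h4 := Finset.single_le_sum (f := fun j => -(D i j * q j))
      (fun j hj => neg_nonneg.2 (hle j hj)) (Finset.mem_univ j)
    rw [Finset.sum_neg_distrib, h1] at h4
    have := mul_neg_of_neg_of_pos h2 h3
    have := hb i
    linarith

end ZMatrix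

/-! ### The entry contributed by eliminated vertices -/

section Fill

variable {W : Set α} [Fintype W] [DecidableEq W]

/-- The potential on `W` induced by a unit potential at `v`. -/
noncomputable def potential (D : Matrix W W ℝ) (m : α → α → ℝ) (v : α) : W → ℝ :=
  D⁻¹ *ᵥ (-fun i : W => m v i)

/-- The contribution to the entry `u, v` when `W` is eliminated. -/
noncomputable def fill (D : Matrix W W ℝ) (m : α → α → ℝ) (u v : α) : ℝ :=
  (fun i : W => m u i) ⬝ᵥ potential D m v

theorem mulVec_potential {D : Matrix W W ℝ} (hD : D.PosDef) (m : α → α → ℝ) (v : α) :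
    D *ᵥ potential D m v = -fun i : W => m v i := by
  rw [potential, mulVec_mulVec, mul_nonsing_inv _ ((isUnit_iff_isUnit_det D).1 hD.isUnit),
    one_mulVec]

theorem eq_potential {D : Matrix W W ℝ} (hD : D.PosDef) {m : α → α → ℝ} {v : α} {q : W → ℝ}
    (h : D *ᵥ q = -fun i : W => m v i) : q = potential D m v := by
  rw [potential, ← h, mulVec_mulVec, nonsing_inv_mul _ ((isUnit_iff_isUnit_det D).1 hD.isUnit),
    one_mulVec]

theorem fill_comm {D : Matrix W W ℝ} (hD : D.PosDef) (m : α → α → ℝ) (u v : α) :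
    fill D m u v = fill D m v u := by
  have hDs : D⁻¹ᵀ = D⁻¹ := by
    rw [transpose_nonsing_inv]
    congr 1
    simpa [conjTranspose_eq_transpose_of_trivial] using hD.isHermitian.eq
  rw [fill, fill, potential, potential, dotProduct_mulVec, dotProduct_comm, ← mulVec_transpose,
    hDs, mulVec_neg, dotProduct_neg, neg_dotProduct]

theorem potential_smul {D : Matrix W W ℝ} (hD : D.PosDef) (m : α → α → ℝ) {c : ℝ} (hc : 0 < c)
    (v : α) : potential (c • D) (c • m) v = potential D m v := by
  refine (eq_potential (hD.smul hc) ?_).symm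
  rw [smul_mulVec, mulVec_potential hD]
  ext i
  simp

/-- Weights that can be switched to be nonpositive induce a potential of constant sign. -/
theorem switched_potential {D : Matrix W W ℝ} (hD : D.PosDef) {m : α → α → ℝ}
    (hm : ∀ i j : W, i ≠ j → D i j = m i j) {σ : α → ℝ} (hσ : ∀ x, σ x = 1 ∨ σ x = -1)
    (hneg : ∀ (x : α) (i : W), x ≠ i → σ x * σ i * m x i ≤ 0) {v : α} (hv : v ∉ W) :
    (∀ i : W, 0 ≤ σ i * σ v * potential D m v i) ∧
    ∀ i : W, (σ v * σ i * m v i < 0 ∨ ∃ j : W, i ≠ j ∧ σ i * σ j * m i j < 0 ∧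
      0 < σ j * σ v * potential D m v j) → 0 < σ i * σ v * potential D m v i := by
  have hsq : ∀ x, σ x * σ x = 1 := fun x => by rcases hσ x with h | h <;> simp [h]
  -- Conjugation by the signs makes the off-diagonal entries nonpositive, so the previous section
  -- applies to the switched potential.
  let T : Matrix W W ℝ := diagonal fun i => σ i
  have hTt : Tᴴ = T := by simp [T]
  have hTT : T * T = 1 := by
    simp only [T, diagonal_mul_diagonal, hsq]; exact diagonal_one
  have hT : IsUnit T := IsUnit.of_mul_eq_one T hTT
  have hD' : (T * D * T).PosDef := by
    have := hD.conjTranspose_mul_mul_same (B := T) (mulVec_injective_iff_isUnit.2 hT)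
    rwa [hTt] at this
  have hDij : ∀ i j, (T * D * T) i j = σ i * D i j * σ j := fun i j => by
    simp [T, mul_diagonal, diagonal_mul]
  let q : W → ℝ := fun i => σ i * σ v * potential D m v i
  let b : W → ℝ := fun i => σ v * σ i * m v i
  have hq : (T * D * T) *ᵥ q = -b := by
    have h1 : T *ᵥ q = σ v • potential D m v := by
      ext i
      simp only [T, q, mulVec_diagonal, Pi.smul_apply, smul_eq_mul]
      linear_combination (σ v * potential D m v i) * hsq i
    rw [← mulVec_mulVec, h1, ← mulVec_mulVec, mulVec_smul, mulVec_potential hD]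
    ext i
    simp only [T, b, mulVec_diagonal, Pi.smul_apply, smul_eq_mul, Pi.neg_apply]
    ring
  have hb : ∀ i, b i ≤ 0 := fun i => hneg v i (fun h => hv (h ▸ i.2))
  have hz : ∀ i j, i ≠ j → (T * D * T) i j ≤ 0 := fun i j hij => by
    rw [hDij, hm i j hij]
    have := hneg i j (fun h => hij (Subtype.ext h))
    linarith
  refine ⟨nonneg_of_mulVec_eq_neg hD' hz hq hb, fun i h => ?_⟩
  refine pos_of_mulVec_eq_neg hD' hz hq hb (h.imp_right ?_)
  rintro ⟨j, hij, h1, h2⟩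
  refine ⟨j, hij, ?_, h2⟩
  rw [hDij, hm i j hij]
  linarith

/-- If the weights can be switched to be nonpositive, with strict signs on the edges of a walk
to `v`, then the potential does not vanish on this walk. -/
theorem switched_potential_pos {H : SignedGraph α β} {D : Matrix W W ℝ} (hD : D.PosDef)
    {m : α → α → ℝ} (hm : ∀ i j : W, i ≠ j → D i j = m i j) (hs : ∀ x y, m x y = m y x)
    {σ : α → ℝ} (hσ : ∀ x, σ x = 1 ∨ σ x = -1)
    (hneg : ∀ (x : α) (i : W), x ≠ i → σ x * σ i * m x i ≤ 0) {x v : α} (hv : v ∉ W)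
    (p : Walk H x v) (hp : ∀ y ∈ p.support, y ∈ W ∨ y = v)
    (hlink : ∀ e ∈ p.edges, ∀ y z, H.graph.IsLink e y z → z ∈ W → σ y * σ z * m y z < 0)
    (hx : x ∈ W) : 0 < σ x * σ v * potential D m v ⟨x, hx⟩ := by
  induction p with
  | nil => exact absurd hx hv
  | @cons x y v e h p ih =>
    -- Positivity spreads backwards along the walk, starting at the neighbour of `v`.
    refine (switched_potential hD hm hσ hneg hv).2 ⟨x, hx⟩ ?_
    have he := hlink e (by simp [Walk.edges]) y x h.symm hx
    rcases hp y (by simp [Walk.support, p.start_mem_support]) with hy | rfl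
    · right
      refine ⟨⟨y, hy⟩, ?_, ?_, ?_⟩
      · intro hxy
        have : x = y := congrArg Subtype.val hxy
        have hl := H.loopless
        exact H.graph.not_isLoopAt e x (this ▸ h)
      · rw [hs]
        simp only
        linarith
      · exact ih hv (fun z hz => hp z (by simp [Walk.support, hz]))
          (fun e' he' => hlink e' (by simp [Walk.edges, he'])) hy
    · exact Or.inl he

theorem switched_fill_nonpos {D : Matrix W W ℝ} (hD : D.PosDef)
    {m : α → α → ℝ} (hm : ∀ i j : W, i ≠ j → D i j = m i j)
    {σ : α → ℝ} (hσ : ∀ x, σ x = 1 ∨ σ x = -1)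
    (hneg : ∀ (x : α) (i : W), x ≠ i → σ x * σ i * m x i ≤ 0) {u v : α} (hu : u ∉ W)
    (hv : v ∉ W) : σ u * σ v * fill D m u v ≤ 0 := by
  have h1 := (switched_potential hD hm hσ hneg hv).1
  rw [fill, dotProduct, Finset.mul_sum]
  refine Finset.sum_nonpos fun i _ => ?_
  have := mul_nonpos_of_nonpos_of_nonneg (hneg u i (fun h => hu (h ▸ i.2))) (h1 i)
  have hsq : σ i * σ i = 1 := by rcases hσ i with h | h <;> simp [h]
  linear_combination this - (σ u * σ v * m u i * potential D m v i) * hsq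

/-- All terms of the switched sum are nonpositive. The first step of the path does not go straight
to `v`, so it enters `W`, and the term of the vertex reached is strictly negative. -/
theorem switched_fill_neg {H : SignedGraph α β} {D : Matrix W W ℝ} (hD : D.PosDef)
    {m : α → α → ℝ} (hm : ∀ i j : W, i ≠ j → D i j = m i j) (hs : ∀ x y, m x y = m y x)
    {σ : α → ℝ} (hσ : ∀ x, σ x = 1 ∨ σ x = -1)
    (hneg : ∀ (x : α) (i : W), x ≠ i → σ x * σ i * m x i ≤ 0) {u v : α} (huv : u ≠ v)
    (hu : u ∉ W) (hv : v ∉ W) {p : Walk H u v} (hpath : p.IsPath)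
    (hp : ∀ y ∈ p.support, y ∈ W ∨ y = u ∨ y = v) (hdir : ∀ e ∈ p.edges, ¬ H.graph.IsLink e u v)
    (hlink : ∀ e ∈ p.edges, ∀ y z, H.graph.IsLink e y z → z ∈ W → σ y * σ z * m y z < 0) :
    σ u * σ v * fill D m u v < 0 := by
  have h1 := (switched_potential hD hm hσ hneg hv).1
  cases p with
  | nil => exact absurd rfl huv
  | @cons _ x _ e h p =>
    simp only [Walk.IsPath, Walk.support, List.nodup_cons] at hpath
    have hxv : x ≠ v := fun hxv => hdir e (by simp [Walk.edges]) (hxv ▸ h)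
    have hsupp : ∀ y ∈ p.support, y ∈ W ∨ y = v := fun y hy => by
      rcases hp y (by simp [Walk.support, hy]) with h2 | rfl | h2
      · exact Or.inl h2
      · exact absurd hy hpath.1
      · exact Or.inr h2
    have hx : x ∈ W := (hsupp x p.start_mem_support).resolve_right hxv
    have h2 := switched_potential_pos hD hm hs hσ hneg hv p hsupp
      (fun e' he' => hlink e' (by simp [Walk.edges, he'])) hx
    have h3 := hlink e (by simp [Walk.edges]) u x h hx
    have hle : ∀ i : W, σ u * σ v * (m u i * potential D m v i) ≤ 0 := fun i => by
      have := mul_nonpos_of_nonpos_of_nonneg (hneg u i (fun h => hu (h ▸ i.2))) (h1 i)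
      have hsq : σ i * σ i = 1 := by rcases hσ i with h | h <;> simp [h]
      linear_combination this - (σ u * σ v * m u i * potential D m v i) * hsq
    rw [fill, dotProduct, Finset.mul_sum]
    refine Finset.sum_neg' (fun i _ => hle i) ⟨⟨x, hx⟩, Finset.mem_univ _, ?_⟩
    have := mul_neg_of_neg_of_pos h3 h2
    have hsq : σ x * σ x = 1 := by rcases hσ x with h | h <;> simp [h]
    linear_combination this - (σ u * σ v * m u x * potential D m v ⟨x, hx⟩) * hsq

/-! ### Weights with dominant diagonal -/

/-- The matrix with off-diagonal entries `m` and a large constant diagonal. -/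
def dominantMatrix (W : Set α) [Fintype W] [DecidableEq W] (m : α → α → ℝ) : Matrix W W ℝ :=
  fun i j => if i = j then Fintype.card W + 1 else m i j

/-- The quadratic form is at least $(|W|+1)\sum x_i^2-(\sum|x_i|)^2$, which by Cauchy–Schwarz is at
least $\sum x_i^2$. -/
theorem dominantMatrix_posDef {m : α → α → ℝ} (hs : ∀ x y, m x y = m y x)
    (hb : ∀ x y, |m x y| ≤ 1) : (dominantMatrix W m).PosDef := by
  refine posDef_iff_dotProduct_mulVec.2 ⟨?_, fun x hx => ?_⟩
  · ext i j
    simp only [conjTranspose_apply, dominantMatrix, star_trivial, eq_comm (a := j), hs j]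
  · rw [star_trivial]
    have h1 : ∀ i j, (if i = j then (Fintype.card W + 1 : ℝ) * x i ^ 2 else 0) - |x i| * |x j| ≤
        x i * (dominantMatrix W m i j * x j) := fun i j => by
      by_cases hij : i = j
      · subst hij
        simp only [dominantMatrix, if_true]
        nlinarith [mul_nonneg (abs_nonneg (x i)) (abs_nonneg (x i))]
      · simp only [dominantMatrix, if_neg hij]
        have h2 : |m i j * (x i * x j)| ≤ |x i| * |x j| := by
          rw [abs_mul, abs_mul]
          exact mul_le_of_le_one_left (by positivity) (hb _ _)
        have := neg_le_of_abs_le h2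
        linarith
    have h2 : (∑ i, |x i|) ^ 2 ≤ Fintype.card W * ∑ i, x i ^ 2 := by
      simpa using sq_sum_le_card_mul_sum_sq (s := Finset.univ) (f := fun i => |x i|)
    have h3 : 0 < ∑ i, x i ^ 2 := by
      obtain ⟨i, hi⟩ := Function.ne_iff.1 hx
      exact Finset.sum_pos' (fun i _ => sq_nonneg _) ⟨i, Finset.mem_univ _, by
        have : x i ≠ 0 := hi
        positivity⟩
    have h4 : ∑ i, ∑ j, ((if i = j then (Fintype.card W + 1 : ℝ) * x i ^ 2 else 0) -
        |x i| * |x j|) = (Fintype.card W + 1) * ∑ i, x i ^ 2 - (∑ i, |x i|) ^ 2 := by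
      simp only [Finset.sum_sub_distrib, Finset.sum_ite_eq, Finset.mem_univ, if_true]
      rw [← Finset.mul_sum, sq, Finset.sum_mul_sum]
    have h5 : x ⬝ᵥ dominantMatrix W m *ᵥ x =
        ∑ i, ∑ j, x i * (dominantMatrix W m i j * x j) := by
      simp only [dotProduct, mulVec, Finset.mul_sum]
    rw [h5]
    refine lt_of_lt_of_le ?_ (Finset.sum_le_sum fun i _ => Finset.sum_le_sum fun j _ => h1 i j)
    rw [h4]
    linarith

/-- The segment between two weight functions. -/
def mix (m m' : α → α → ℝ) (t : ℝ) : α → α → ℝ := fun x y => (1 - t) * m x y + t * m' x y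

theorem abs_mix_le {m m' : α → α → ℝ} (hb : ∀ x y, |m x y| ≤ 1) (hb' : ∀ x y, |m' x y| ≤ 1)
    {t : ℝ} (ht : t ∈ Set.Icc (0 : ℝ) 1) (x y : α) : |mix m m' t x y| ≤ 1 := by
  have h1 := abs_le.1 (hb x y)
  have h2 := abs_le.1 (hb' x y)
  obtain ⟨h3, h4⟩ := ht
  rw [mix, abs_le]
  constructor <;> nlinarith

theorem mix_comm {m m' : α → α → ℝ} (hs : ∀ x y, m x y = m y x) (hs' : ∀ x y, m' x y = m' y x)
    (t : ℝ) (x y : α) : mix m m' t x y = mix m m' t y x := by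
  rw [mix, mix, hs, hs']

/-- On the unit interval the mixed weights stay bounded by 1, so the determinant under the inverse
never vanishes. -/
theorem continuousOn_fill {m m' : α → α → ℝ} (hs : ∀ x y, m x y = m y x)
    (hs' : ∀ x y, m' x y = m' y x) (hb : ∀ x y, |m x y| ≤ 1) (hb' : ∀ x y, |m' x y| ≤ 1)
    (u v : α) : ContinuousOn
      (fun t => fill (dominantMatrix W (mix m m' t)) (mix m m' t) u v) (Set.Icc 0 1) := by
  have hc : ∀ x y, Continuous fun t => mix m m' t x y := fun x y => by
    unfold mix; fun_prop
  have hD : Continuous fun t => dominantMatrix W (mix m m' t) := by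
    refine continuous_matrix fun i j => ?_
    unfold dominantMatrix
    split_ifs
    · exact continuous_const
    · exact hc _ _
  have hinv : ContinuousOn (fun t => (dominantMatrix W (mix m m' t))⁻¹) (Set.Icc 0 1) := by
    simp only [inv_def, Ring.inverse_eq_inv']
    refine ContinuousOn.smul (ContinuousOn.inv₀ hD.matrix_det.continuousOn fun t ht => ?_)
      hD.matrix_adjugate.continuousOn
    exact (dominantMatrix_posDef (mix_comm hs hs' t) (abs_mix_le hb hb' ht)).det_pos.ne'
  unfold fill potential
  simp only [dotProduct, mulVec]
  refine continuousOn_finsetSum _ fun i _ => (hc _ _).continuousOn.mul ?_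
  refine continuousOn_finsetSum _ fun j _ => ContinuousOn.mul ?_ (hc _ _).neg.continuousOn
  exact ((continuous_apply_apply i j).comp_continuousOn hinv)

end Fill

end SignedGraph

namespace SignedGraph

open Matrix

variable {α β : Type*}

/-! ### Gadgets -/

theorem EvenAdj.symm {G : SignedGraph α β} {x y : α} (h : G.EvenAdj x y) : G.EvenAdj y x := by
  obtain ⟨e, he, hl⟩ := h
  exact ⟨e, he, hl.symm⟩

theorem OddAdj.symm {G : SignedGraph α β} {x y : α} (h : G.OddAdj x y) : G.OddAdj y x := by
  obtain ⟨e, he, hl⟩ := h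
  exact ⟨e, he, hl.symm⟩

theorem adj_iff (G : SignedGraph α β) (x y : α) :
    G.graph.Adj x y ↔ G.EvenAdj x y ∨ G.OddAdj x y := by
  constructor
  · rintro ⟨e, h⟩
    by_cases he : e ∈ G.odd
    · exact Or.inr ⟨e, he, h⟩
    · exact Or.inl ⟨e, he, h⟩
  · rintro (⟨e, -, h⟩ | ⟨e, -, h⟩) <;> exact ⟨e, h⟩

open Classical in
/-- Weights `-1` and `1` for adjacencies by even and by odd edges only. -/
noncomputable def unitWeight (G : SignedGraph α β) (x y : α) : ℝ :=
  if G.EvenAdj x y then if G.OddAdj x y then 0 else -1 else if G.OddAdj x y then 1 else 0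

theorem unitWeight_comm (G : SignedGraph α β) (x y : α) :
    G.unitWeight x y = G.unitWeight y x := by
  have h1 : G.EvenAdj x y ↔ G.EvenAdj y x := ⟨EvenAdj.symm, EvenAdj.symm⟩
  have h2 : G.OddAdj x y ↔ G.OddAdj y x := ⟨OddAdj.symm, OddAdj.symm⟩
  simp only [unitWeight]
  split_ifs <;> first | rfl | (exfalso; tauto)

theorem abs_unitWeight_le (G : SignedGraph α β) (x y : α) : |G.unitWeight x y| ≤ 1 := by
  unfold unitWeight
  split_ifs <;> simp

theorem unitWeight_pattern (G : SignedGraph α β) :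
    SignPattern G.EvenAdj G.OddAdj G.unitWeight := by
  intro x y _
  refine ⟨fun h1 h2 => ?_, fun h1 h2 => ?_, fun h => ?_⟩
  · simp [unitWeight, h1, h2]
  · simp [unitWeight, h1, h2]
  · rw [not_or] at h
    simp [unitWeight, h.1, h.2]

theorem SignPattern.mix {ev od : α → α → Prop} {m m' : α → α → ℝ} (h : SignPattern ev od m)
    (h' : SignPattern ev od m') {t : ℝ} (ht : t ∈ Set.Icc (0 : ℝ) 1) :
    SignPattern ev od (mix m m' t) := by
  intro x y hxy
  obtain ⟨a1, a2, a3⟩ := h x y hxy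
  obtain ⟨b1, b2, b3⟩ := h' x y hxy
  obtain ⟨ht0, ht1⟩ := ht
  unfold SignedGraph.mix
  refine ⟨fun h1 h2 => ?_, fun h1 h2 => ?_, fun h1 => by rw [a3 h1, b3 h1]; simp⟩
  · have := a1 h1 h2
    have := b1 h1 h2
    rcases ht0.eq_or_lt with rfl | ht0 <;> nlinarith
  · have := a2 h1 h2
    have := b2 h1 h2
    rcases ht0.eq_or_lt with rfl | ht0 <;> nlinarith

variable {W : Set α} {H : SignedGraph α β} {u v : α}

/-- Weights `m` obeying the sign pattern of `H`, with a positive definite matrix `D` on `W`. -/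
structure Gadget (H : SignedGraph α β) (D : Matrix W W ℝ) (m : α → α → ℝ) : Prop where
  posDef : D.PosDef
  comm : ∀ x y, m x y = m y x
  pattern : SignPattern H.EvenAdj H.OddAdj m
  off_diag : ∀ i j : W, i ≠ j → D i j = m i j

theorem Gadget.smul {D : Matrix W W ℝ} {m : α → α → ℝ} (h : Gadget H D m) {c : ℝ} (hc : 0 < c) :
    Gadget H (c • D) (c • m) where
  posDef := h.posDef.smul hc
  comm x y := by simp [h.comm x y]
  pattern x y hxy := by
    obtain ⟨h1, h2, h3⟩ := h.pattern x y hxy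
    simp only [Pi.smul_apply, smul_eq_mul]
    exact ⟨fun a b => mul_neg_of_pos_of_neg hc (h1 a b), fun a b => mul_pos hc (h2 a b),
      fun a => by rw [h3 a, mul_zero]⟩
  off_diag i j hij := by simp [h.off_diag i j hij]

variable [Fintype W] [DecidableEq W]

/-- The condition by which the Strong Arnold Property extends over `W`. -/
def Nondegenerate (H : SignedGraph α β) (D : Matrix W W ℝ) (m : α → α → ℝ) (u v : α) : Prop :=
  (∃ i : W, H.graph.Adj u i ∧ potential D m v i ≠ 0) ∨
  (∃ i : W, H.graph.Adj v i ∧ potential D m u i ≠ 0) ∨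
  ∃ i j : W, (H.graph.Adj i j ∨ i = j) ∧
    potential D m u i * potential D m v j + potential D m u j * potential D m v i ≠ 0

theorem gadget_dominantMatrix {m : α → α → ℝ} (hs : ∀ x y, m x y = m y x)
    (hb : ∀ x y, |m x y| ≤ 1) (hp : SignPattern H.EvenAdj H.OddAdj m) :
    Gadget H (dominantMatrix W m) m :=
  ⟨dominantMatrix_posDef hs hb, hs, hp, fun _ _ hij => if_neg hij⟩

theorem Gadget.fill_smul {D : Matrix W W ℝ} {m : α → α → ℝ} (h : Gadget H D m) {c : ℝ}
    (hc : 0 < c) (u v : α) : fill (c • D) (c • m) u v = c * fill D m u v := by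
  rw [fill, fill, potential_smul h.posDef m hc, ← smul_eq_mul, ← smul_dotProduct]
  rfl

/-- A nonzero term of `fill` exhibits a neighbour of `u` at which the potential of `v` is nonzero.
-/
theorem Gadget.nondegenerate {D : Matrix W W ℝ} {m : α → α → ℝ} (h : Gadget H D m) (hu : u ∉ W)
    (hf : fill D m u v ≠ 0) : Nondegenerate H D m u v := by
  obtain ⟨i, -, hi⟩ := Finset.exists_ne_zero_of_sum_ne_zero hf
  refine Or.inl ⟨i, ?_, right_ne_zero_of_mul hi⟩
  by_contra hadj
  rw [adj_iff] at hadj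
  exact left_ne_zero_of_mul hi ((h.pattern u i (fun h => hu (h ▸ i.2))).2.2 hadj)

/-! ### Gadgets with a prescribed contribution -/

theorem exists_gadget_small (H : SignedGraph α β) (W : Set α) [Fintype W] [DecidableEq W]
    (u v : α) {ε : ℝ} (hε : 0 < ε) :
    ∃ (D : Matrix W W ℝ) (m : α → α → ℝ), Gadget H D m ∧ |fill D m u v| < ε := by
  have h := gadget_dominantMatrix (W := W) H.unitWeight_comm H.abs_unitWeight_le
    H.unitWeight_pattern
  set f := fill (dominantMatrix W H.unitWeight) H.unitWeight u v with hf
  have hc : 0 < ε / (|f| + 1) := by positivity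
  refine ⟨_, _, h.smul hc, ?_⟩
  rw [h.fill_smul hc, ← hf, abs_mul, abs_of_pos hc, div_mul_eq_mul_div, div_lt_iff₀ (by positivity)]
  nlinarith [abs_nonneg f]

/-- A path without a direct edge from `u` to `v`. -/
def HasIndirectPath (H : SignedGraph α β) (u v : α) (s : ℝ) : Prop :=
  ∃ p : Walk H u v, p.IsPath ∧ (∀ e ∈ p.edges, ¬ H.graph.IsLink e u v) ∧
    (-1) ^ p.oddCount = s

/-- Weights living only on the path can be switched to be nonpositive, so their `fill` has sign
$-s$. A small move towards `unitWeight` gives the remaining edges their strict signs, and by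
continuity keeps the sign of `fill`. -/
theorem exists_weight_of_indirectPath (hW : V(H.graph) ⊆ W ∪ {u, v}) (huv : u ≠ v) (hu : u ∉ W)
    (hv : v ∉ W) {s : ℝ} (hp : HasIndirectPath H u v s) :
    ∃ m : α → α → ℝ, (∀ x y, m x y = m y x) ∧ (∀ x y, |m x y| ≤ 1) ∧
      SignPattern H.EvenAdj H.OddAdj m ∧ s * fill (dominantMatrix W m) m u v < 0 := by
  classical
  obtain ⟨p, hpath, hdir, rfl⟩ := hp
  obtain ⟨σ, hσ, hσe⟩ := hpath.exists_switching
  rw [← p.switching_eq hσ hσe]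
  have hsq : ∀ x, σ x * σ x = 1 := fun x => by rcases hσ x with h | h <;> simp [h]
  let m0 : α → α → ℝ := fun x y =>
    if ∃ e ∈ p.edges, H.graph.IsLink e x y then -(σ x * σ y) else 0
  have hs : ∀ x y, m0 x y = m0 y x := fun x y => by
    simp only [m0, H.graph.isLink_comm (x := x), mul_comm (σ x)]
  have hb : ∀ x y, |m0 x y| ≤ 1 := fun x y => by
    simp only [m0]
    split_ifs
    · rcases hσ x with h | h <;> rcases hσ y with h' | h' <;> simp [h, h']
    · simp
  have hneg : ∀ x y, (∃ e ∈ p.edges, H.graph.IsLink e x y) → σ x * σ y * m0 x y = -1 := by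
    intro x y h
    simp only [m0, if_pos h]
    linear_combination -(σ y * σ y) * hsq x - hsq y
  have hf0 : σ u * σ v * fill (dominantMatrix W m0) m0 u v < 0 := by
    refine switched_fill_neg (dominantMatrix_posDef hs hb) (fun i j hij => if_neg hij) hs hσ
      (fun x i _ => ?_) huv hu hv hpath (fun y hy => hW (p.mem_vertexSet_of_mem_support hy)) hdir
      (fun e he y z hyz _ => ?_)
    · by_cases h : ∃ e ∈ p.edges, H.graph.IsLink e x i
      · rw [hneg x i h]; norm_num
      · simp only [m0, if_neg h, mul_zero, le_refl]
    · rw [hneg y z ⟨e, he, hyz⟩]; norm_num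
  have hcont := (continuousOn_fill (W := W) hs H.unitWeight_comm hb H.abs_unitWeight_le u v).const_mul
    (σ u * σ v)
  have hm0 : mix m0 H.unitWeight 0 = m0 := by
    ext x y; simp [mix]
  have h0 := hcont 0 ⟨le_refl _, zero_le_one⟩
  have h1 : ∀ᶠ t in nhdsWithin (0 : ℝ) (Set.Icc 0 1), σ u * σ v *
      fill (dominantMatrix W (mix m0 H.unitWeight t)) (mix m0 H.unitWeight t) u v < 0 := by
    refine h0.eventually (gt_mem_nhds ?_)
    simp only [hm0]
    exact hf0
  have h2 : ∀ᶠ t in nhdsWithin (0 : ℝ) (Set.Ioc 0 1), σ u * σ v *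
      fill (dominantMatrix W (mix m0 H.unitWeight t)) (mix m0 H.unitWeight t) u v < 0 :=
    h1.filter_mono (nhdsWithin_mono _ Set.Ioc_subset_Icc_self)
  have : (nhdsWithin (0 : ℝ) (Set.Ioc 0 1)).NeBot := by
    rw [nhdsWithin_Ioc_eq_nhdsGT zero_lt_one]; infer_instance
  obtain ⟨t, ht, htI⟩ := (h2.and self_mem_nhdsWithin).exists
  refine ⟨mix m0 H.unitWeight t, mix_comm hs H.unitWeight_comm t,
    abs_mix_le hb H.abs_unitWeight_le (Set.Ioc_subset_Icc_self htI), ?_, ht⟩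
  intro x y hxy
  obtain ⟨a1, a2, a3⟩ := H.unitWeight_pattern x y hxy
  -- The path weights agree in sign with the path edges, so on pairs joined by edges of one parity
  -- they obey the pattern weakly.
  have hodd : ∀ e ∈ p.edges, H.graph.IsLink e x y → (e ∈ H.odd ∧ m0 x y = 1) ∨
      (e ∉ H.odd ∧ m0 x y = -1) := by
    intro e he hl
    have h3 := hσe e he x y hl
    by_cases ho : e ∈ H.odd
    · refine Or.inl ⟨ho, ?_⟩
      simp only [m0]
      rw [if_pos ⟨e, he, hl⟩, h3, edgeSign_of_odd ho, neg_neg]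
    · refine Or.inr ⟨ho, ?_⟩
      simp only [m0]
      rw [if_pos ⟨e, he, hl⟩, h3, edgeSign_of_even ho]
  have hnone : (¬ ∃ e ∈ p.edges, H.graph.IsLink e x y) → m0 x y = 0 := fun h => if_neg h
  obtain ⟨ht0, ht1⟩ := htI
  unfold mix
  refine ⟨fun h1 h2 => ?_, fun h1 h2 => ?_, fun h1 => ?_⟩
  · have h3 : m0 x y ≤ 0 := by
      by_cases h : ∃ e ∈ p.edges, H.graph.IsLink e x y
      · obtain ⟨e, he, hl⟩ := h
        rcases hodd e he hl with ⟨ho, -⟩ | ⟨-, h4⟩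
        · exact absurd ⟨e, ho, hl⟩ h2
        · rw [h4]; norm_num
      · rw [hnone h]
    nlinarith [a1 h1 h2]
  · have h3 : 0 ≤ m0 x y := by
      by_cases h : ∃ e ∈ p.edges, H.graph.IsLink e x y
      · obtain ⟨e, he, hl⟩ := h
        rcases hodd e he hl with ⟨-, h4⟩ | ⟨ho, -⟩
        · rw [h4]; norm_num
        · exact absurd ⟨e, ho, hl⟩ h2
      · rw [hnone h]
    nlinarith [a2 h1 h2]
  · rw [a3 h1, hnone ?_]
    · simp
    · rintro ⟨e, -, hl⟩
      exact h1 ((H.adj_iff x y).1 ⟨e, hl⟩)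

/-- If the contribution vanishes for some weights but not for all, then it vanishes for some
nondegenerate weights. -/
theorem exists_nondegenerate {m m' : α → α → ℝ} (hu : u ∉ W) (hv : v ∉ W) (huv : u ≠ v)
    (hs : ∀ x y, m x y = m y x) (hs' : ∀ x y, m' x y = m' y x) (hb : ∀ x y, |m x y| ≤ 1)
    (hb' : ∀ x y, |m' x y| ≤ 1) (hp : SignPattern H.EvenAdj H.OddAdj m)
    (hp' : SignPattern H.EvenAdj H.OddAdj m') (h0 : fill (dominantMatrix W m) m u v = 0)
    (h0' : fill (dominantMatrix W m') m' u v ≠ 0) :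
    ∃ (D : Matrix W W ℝ) (n : α → α → ℝ), Gadget H D n ∧ fill D n u v = 0 ∧
      Nondegenerate H D n u v := by
  classical
  have hD := dominantMatrix_posDef (W := W) hs hb
  have hD' := dominantMatrix_posDef (W := W) hs' hb'
  set p := potential (dominantMatrix W m) m u with hpdef
  -- `n` differs from `m` only between zeros of the potential `p` of `u`. Hence `p` remains the
  -- potential of `u`, and `fill` remains 0.
  let z : α → Prop := fun x => x ≠ u ∧ ∀ h : x ∈ W, p ⟨x, h⟩ = 0
  let n : α → α → ℝ := fun x y => if z x ∧ z y then m' x y else m x y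
  have hns : ∀ x y, n x y = n y x := fun x y => by
    simp only [n, and_comm (a := z x), hs x y, hs' x y]
  have hnb : ∀ x y, |n x y| ≤ 1 := fun x y => by
    simp only [n]; split_ifs <;> simp [hb, hb']
  have hnp : SignPattern H.EvenAdj H.OddAdj n := fun x y hxy => by
    simp only [n]
    split_ifs
    · exact hp' x y hxy
    · exact hp x y hxy
  have hDn := dominantMatrix_posDef (W := W) hns hnb
  have hz : ∀ i : W, z i ↔ p i = 0 := fun i =>
    ⟨fun h => h.2 i.2, fun h => ⟨fun hi => hu (hi ▸ i.2), fun _ => h⟩⟩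
  have hnu : ∀ y, n u y = m u y := fun y => if_neg fun h => h.1.1 rfl
  have hpn : p = potential (dominantMatrix W n) n u := by
    refine eq_potential hDn ?_
    have h1 := mulVec_potential hD m u
    rw [← hpdef] at h1
    simp only [hnu]
    rw [← h1]
    ext i
    refine Finset.sum_congr rfl fun j _ => ?_
    by_cases hj : p j = 0
    · rw [hj, mul_zero, mul_zero]
    · congr 1
      simp only [dominantMatrix, n]
      rw [if_neg fun h : z i ∧ z j => hj ((hz j).1 h.2)]
  have hfn : fill (dominantMatrix W n) n u v = 0 := by
    rw [fill_comm hDn, fill, ← hpn, ← h0, fill_comm hD, fill, ← hpdef]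
    refine Finset.sum_congr rfl fun j _ => ?_
    by_cases hj : p j = 0
    · rw [hj, mul_zero, mul_zero]
    · congr 1
      exact if_neg fun h : z v ∧ z j => hj ((hz j).1 h.2)
  refine ⟨_, n, gadget_dominantMatrix hns hnb hnp, hfn, ?_⟩
  -- In the degenerate case the potential `q` of `v` vanishes wherever `n` and `m'` could differ on
  -- an edge. So `q` is also the potential of `v` for `m'`; being zero at the neighbours of `u`, it
  -- makes the `fill` of `m'` zero.
  by_contra hdeg
  unfold Nondegenerate at hdeg
  rw [← hpn] at hdeg
  set q := potential (dominantMatrix W n) n v with hqdef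
  push Not at hdeg
  obtain ⟨d1, d2, d3⟩ := hdeg
  have hpq : ∀ i, p i * q i = 0 := fun i => by
    have := d3 i i (Or.inr rfl)
    linarith
  have hpq' : ∀ i j : W, H.graph.Adj i j → ¬ (p i = 0 ∧ p j = 0) → q i = 0 ∧ q j = 0 := by
    intro i j hij hne
    have h1 := d3 i j (Or.inl hij)
    have h2 := hpq i
    have h3 := hpq j
    by_cases hi : p i = 0
    · have hj : p j ≠ 0 := fun h => hne ⟨hi, h⟩
      rw [hi, zero_mul, zero_add] at h1
      exact ⟨(mul_eq_zero.1 h1).resolve_left hj, (mul_eq_zero.1 h3).resolve_left hj⟩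
    · have hqi := (mul_eq_zero.1 h2).resolve_left hi
      rw [hqi, mul_zero, add_zero] at h1
      exact ⟨hqi, (mul_eq_zero.1 h1).resolve_left hi⟩
  have hq' : q = potential (dominantMatrix W m') m' v := by
    refine eq_potential hD' ?_
    have h1 := mulVec_potential hDn n v
    rw [← hqdef] at h1
    have h2 : (fun i : W => m' v i) = fun i : W => n v i := by
      ext i
      by_cases hi : p i = 0
      · have hzv : z v := ⟨huv.symm, fun h => absurd h hv⟩
        simp only [n]
        rw [if_pos ⟨hzv, (hz i).2 hi⟩]
      · have hadj : ¬ H.graph.Adj v i := fun h => hi (d2 i h)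
        rw [adj_iff] at hadj
        have hne : v ≠ i := fun h => hv (h ▸ i.2)
        rw [(hp' v i hne).2.2 hadj, (hnp v i hne).2.2 hadj]
    rw [h2, ← h1]
    ext i
    refine Finset.sum_congr rfl fun j _ => ?_
    by_cases hij : i = j
    · simp [dominantMatrix, hij]
    · simp only [dominantMatrix, if_neg hij]
      have hne : (i : α) ≠ j := fun h => hij (Subtype.ext h)
      by_cases hadj : H.graph.Adj i j
      · by_cases hpp : p i = 0 ∧ p j = 0
        · congr 1
          simp only [n]
          rw [if_pos ⟨(hz i).2 hpp.1, (hz j).2 hpp.2⟩]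
        · rw [(hpq' i j hadj hpp).2, mul_zero, mul_zero]
      · rw [adj_iff] at hadj
        rw [(hp' i j hne).2.2 hadj, (hnp i j hne).2.2 hadj]
  apply h0'
  rw [fill, ← hq']
  refine Finset.sum_eq_zero fun i _ => ?_
  by_cases hadj : H.graph.Adj u i
  · rw [d1 i hadj, mul_zero]
  · rw [adj_iff] at hadj
    simp only [(hp' u i (fun h => hu (h ▸ i.2))).2.2 hadj, zero_mul]

/-- An arbitrary contribution `c` of the appropriate sign is attained by a nondegenerate gadget. -/
theorem exists_gadget_fill_eq (hW : V(H.graph) ⊆ W ∪ {u, v}) (huv : u ≠ v) (hu : u ∉ W)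
    (hv : v ∉ W) (c : ℝ) (hpos : 0 ≤ c → HasIndirectPath H u v (-1))
    (hneg : c ≤ 0 → HasIndirectPath H u v 1) :
    ∃ (D : Matrix W W ℝ) (m : α → α → ℝ), Gadget H D m ∧ fill D m u v = c ∧
      Nondegenerate H D m u v := by
  rcases eq_or_ne c 0 with rfl | hc
  · obtain ⟨m, hs, hb, hp, hf⟩ := exists_weight_of_indirectPath hW huv hu hv (hpos le_rfl)
    obtain ⟨m', hs', hb', hp', hf'⟩ := exists_weight_of_indirectPath hW huv hu hv (hneg le_rfl)
    have hcont := continuousOn_fill (W := W) hs' hs hb' hb u v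
    have h0 : mix m' m 0 = m' := by ext x y; simp [mix]
    have h1 : mix m' m 1 = m := by ext x y; simp [mix]
    -- Paths of both parities give contributions of both signs; the segment between the two weights
    -- crosses 0.
    obtain ⟨t, ht, hft⟩ := intermediate_value_Icc zero_le_one hcont
      (show (0 : ℝ) ∈ Set.Icc _ _ by
        simp only [h0, h1]
        exact ⟨by linarith, by linarith⟩)
    exact exists_nondegenerate hu hv huv (mix_comm hs' hs t) hs (abs_mix_le hb' hb ht) hb
      (hp'.mix hp ht) hp hft (by intro h; rw [h] at hf; simp at hf)
  · obtain ⟨m, hs, hb, hp, hf⟩ : ∃ m : α → α → ℝ, (∀ x y, m x y = m y x) ∧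
        (∀ x y, |m x y| ≤ 1) ∧ SignPattern H.EvenAdj H.OddAdj m ∧
        0 < c / fill (dominantMatrix W m) m u v := by
      rcases hc.lt_or_gt with hc | hc
      · obtain ⟨m, hs, hb, hp, hf⟩ := exists_weight_of_indirectPath hW huv hu hv (hneg hc.le)
        exact ⟨m, hs, hb, hp, div_pos_of_neg_of_neg hc (by linarith)⟩
      · obtain ⟨m, hs, hb, hp, hf⟩ := exists_weight_of_indirectPath hW huv hu hv (hpos hc.le)
        exact ⟨m, hs, hb, hp, div_pos hc (by linarith)⟩
    have hg := (gadget_dominantMatrix (W := W) hs hb hp).smul hf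
    have hne : fill (dominantMatrix W m) m u v ≠ 0 := fun h => by simp [h] at hf
    have hfill := (gadget_dominantMatrix (W := W) hs hb hp).fill_smul hf u v
    rw [div_mul_cancel₀ c hne] at hfill
    exact ⟨_, _, hg, hfill, hg.nondegenerate hu (by rw [hfill]; exact hc)⟩

end SignedGraph

namespace SignedGraph

open Matrix

variable {α β β' : Type*}

/-! ### Attained nullities -/

/-- `k` is the nullity of a positive semidefinite matrix in `S(G, Σ)` with the SAP. -/
def IsNullity [Finite α] (G : SignedGraph α β) (k : ℕ) : Prop :=
  let : Fintype V(G.graph) := Fintype.ofFinite _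
  k ∈ G.nullities

theorem mem_nullities_iff (G : SignedGraph α β) [Fintype V(G.graph)] (k : ℕ) :
    k ∈ G.nullities ↔ ∃ A : Matrix V(G.graph) V(G.graph) ℝ,
      Realizes (fun i j : V(G.graph) => G.EvenAdj i j)
      (fun i j : V(G.graph) => G.OddAdj i j) A k := by
  constructor
  · rintro ⟨A, ⟨hs, hp⟩, hpsd, hsap, hk⟩
    refine ⟨A, hs, fun i j hij => ?_, hpsd, fun X hX hz => hsap X hX fun i j hij => hz i j ?_, hk⟩
    · have := hp i j hij
      rwa [adj_iff] at this
    · rwa [← adj_iff]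
  · rintro ⟨A, hs, hp, hpsd, hsap, hk⟩
    refine ⟨A, ⟨hs, fun i j hij => ?_⟩, hpsd, fun X hX hz => hsap X hX fun i j hij => hz i j ?_, hk⟩
    · rw [adj_iff]; exact hp i j hij
    · rwa [adj_iff]

theorem nu_eq_sSup [Finite α] (G : SignedGraph α β) : G.nu = sSup {k | G.IsNullity k} := rfl

theorem bddAbove_isNullity [Finite α] (G : SignedGraph α β) : BddAbove {k | G.IsNullity k} := by
  let : Fintype V(G.graph) := Fintype.ofFinite _
  refine ⟨Fintype.card V(G.graph), ?_⟩
  rintro k ⟨A, -, -, -, rfl⟩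
  simpa using Submodule.finrank_le (LinearMap.ker A.mulVecLin)

theorem nu_eq_max [Finite α] {β₁ β₂ : Type*} {G : SignedGraph α β} {G₁ : SignedGraph α β₁}
    {G₂ : SignedGraph α β₂} (h : ∀ k, G.IsNullity k ↔ G₁.IsNullity k ∨ G₂.IsNullity k) :
    G.nu = max G₁.nu G₂.nu := by
  have hset : {k | G.IsNullity k} = {k | G₁.IsNullity k} ∪ {k | G₂.IsNullity k} := Set.ext h
  rw [nu_eq_sSup, nu_eq_sSup, nu_eq_sSup, hset]
  -- The empty set has supremum 0 in ℕ, which is neutral for `max`.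
  rcases Set.eq_empty_or_nonempty {k | G₁.IsNullity k} with h1 | h1
  · rw [h1, Set.empty_union]; simp
  · rcases Set.eq_empty_or_nonempty {k | G₂.IsNullity k} with h2 | h2
    · rw [h2, Set.union_empty]; simp
    · exact csSup_union G₁.bddAbove_isNullity h1 G₂.bddAbove_isNullity h2

/-- Attained nullities in terms of matrices indexed by the vertices in `s` and the others. -/
theorem isNullity_iff_sum [Finite α] (G : SignedGraph α β) {s : Set α} (hs : s ⊆ V(G.graph))
    [Fintype s] [Fintype ↥(V(G.graph) \ s)] (k : ℕ) :
    G.IsNullity k ↔ ∃ A : Matrix (s ⊕ ↥(V(G.graph) \ s)) (s ⊕ ↥(V(G.graph) \ s)) ℝ,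
      Realizes
        (fun i j => G.EvenAdj (Sum.elim Subtype.val Subtype.val i)
          (Sum.elim Subtype.val Subtype.val j))
        (fun i j => G.OddAdj (Sum.elim Subtype.val Subtype.val i)
          (Sum.elim Subtype.val Subtype.val j)) A k := by
  classical
  let : Fintype V(G.graph) := Fintype.ofFinite _
  let e := Equiv.Set.sumDiffSubset hs
  have he : ∀ i, ((e i : V(G.graph)) : α) = Sum.elim Subtype.val Subtype.val i := by
    rintro (i | i) <;> simp [e]
  have he' : ∀ i : V(G.graph), (i : α) = Sum.elim Subtype.val Subtype.val (e.symm i) := by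
    intro i; rw [← he, e.apply_symm_apply]
  have h0 : G.IsNullity k ↔ _ := mem_nullities_iff G k
  rw [h0]
  constructor
  · rintro ⟨A, hA⟩
    have := hA.submatrix e
    simp only [he] at this
    exact ⟨_, this⟩
  · rintro ⟨A, hA⟩
    have := hA.submatrix e.symm
    simp only [← he'] at this
    exact ⟨_, this⟩

/-- The minus sign comes from `potential`: elimination adds `fill` to an entry, extension subtracts
it. -/
theorem mul_inv_mul_transpose_apply {N : Type*} {W : Set α} [Fintype W] [DecidableEq W]
    (D : Matrix W W ℝ) (m : α → α → ℝ) (f : N → α) (n n' : N) :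
    ((of fun n (w : W) => m (f n) w) * D⁻¹ * (of fun n (w : W) => m (f n) w)ᵀ) n n' =
      -fill D m (f n) (f n') := by
  rw [fill, potential, Matrix.mul_assoc, mul_apply, dotProduct, ← Finset.sum_neg_distrib]
  refine Finset.sum_congr rfl fun w _ => ?_
  rw [mulVec_neg, Pi.neg_apply, mul_neg, neg_neg]
  rfl

/-! ### Transfer of nullities by elimination and extension -/

section Transfer

variable [Finite α] {G : SignedGraph α β} {G₁ : SignedGraph α β'}
  [Fintype V(G₁.graph)] [Fintype ↥(V(G.graph) \ V(G₁.graph))]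
  [DecidableEq ↥(V(G.graph) \ V(G₁.graph))]

/-- A nullity attained on `G₁` is attained on `G` if a gadget for the other vertices is given. -/
theorem isNullity_extend {H : SignedGraph α β} {k : ℕ} (hV : V(G₁.graph) ⊆ V(G.graph))
    {S : Matrix V(G₁.graph) V(G₁.graph) ℝ}
    (hS : Realizes (fun i j : V(G₁.graph) => G₁.EvenAdj i j)
      (fun i j : V(G₁.graph) => G₁.OddAdj i j) S k)
    {D : Matrix ↥(V(G.graph) \ V(G₁.graph)) ↥(V(G.graph) \ V(G₁.graph)) ℝ} {m : α → α → ℝ}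
    (hg : Gadget H D m)
    (hev : ∀ x, ∀ w ∈ V(G.graph) \ V(G₁.graph), G.EvenAdj x w ↔ H.EvenAdj x w)
    (hod : ∀ x, ∀ w ∈ V(G.graph) \ V(G₁.graph), G.OddAdj x w ↔ H.OddAdj x w)
    (hN : SignPattern (fun i j : V(G₁.graph) => G.EvenAdj i j)
      (fun i j : V(G₁.graph) => G.OddAdj i j) (fun i j => S i j - fill D m i j))
    (hext : ∀ Y : Matrix V(G₁.graph) V(G₁.graph) ℝ, Y.IsSymm →
      (∀ i j : V(G₁.graph), G.graph.Adj i j ∨ i = j → Y i j = 0) →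
      (∀ (i : V(G₁.graph)) (w : ↥(V(G.graph) \ V(G₁.graph))), G.graph.Adj i w →
        ∑ j, Y i j * potential D m j w = 0) →
      (∀ w w' : ↥(V(G.graph) \ V(G₁.graph)), G.graph.Adj w w' ∨ w = w' →
        ∑ i : V(G₁.graph), potential D m i w * ∑ j, Y i j * potential D m j w' = 0) →
      ∀ i j : V(G₁.graph), G₁.graph.Adj i j → Y i j = 0) : G.IsNullity k := by
  classical
  rw [isNullity_iff_sum G hV]
  refine ⟨_, hS.extend (B := of fun (n : V(G₁.graph)) (w : ↥(V(G.graph) \ V(G₁.graph))) => m n w)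
    hg.posDef ?_ ?_⟩
  · rintro (i | i) (j | j) hij
    · rw [fromBlocks_apply₁₁, Matrix.add_apply, mul_inv_mul_transpose_apply, ← sub_eq_add_neg]
      exact hN i j (fun h => hij (congrArg _ h))
    · simp only [Sum.elim_inl, Sum.elim_inr, hev i j j.2, hod i j j.2]
      exact hg.pattern i j (fun h => j.2.2 (h ▸ i.2))
    · simp only [Sum.elim_inl, Sum.elim_inr]
      have h := hg.pattern i j (fun h => i.2.2 (h ▸ j.2))
      have h1 : G.EvenAdj i j ↔ H.EvenAdj i j :=
        ⟨fun h => ((hev j i i.2).1 h.symm).symm, fun h => ((hev j i i.2).2 h.symm).symm⟩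
      have h2 : G.OddAdj i j ↔ H.OddAdj i j :=
        ⟨fun h => ((hod j i i.2).1 h.symm).symm, fun h => ((hod j i i.2).2 h.symm).symm⟩
      rw [h1, h2, fromBlocks_apply₂₁, transpose_apply, of_apply, hg.comm]
      exact h
    · simp only [Sum.elim_inr, hev i j j.2, hod i j j.2, fromBlocks_apply₂₂]
      have hne : i ≠ j := fun h => hij (congrArg _ h)
      rw [hg.off_diag i j hne]
      exact hg.pattern i j (fun h => hne (Subtype.ext h))
  · intro Y P hP hY h1 h2 h3 i j hij
    have hPw : ∀ w (n : V(G₁.graph)), P w n = potential D m n w := by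
      intro w n
      have := eq_potential hg.posDef (m := m) (v := n) (q := fun w => P w n) (by
        ext w
        exact congrFun (congrFun hP w) n)
      exact congrFun this w
    have hYP : ∀ n w, (Y * Pᵀ) n w = ∑ j, Y n j * potential D m j w := by
      intro n w
      simp only [mul_apply, transpose_apply, hPw]
    refine hext Y hY (fun i j h => h1 i j ?_) (fun i w h => ?_) (fun w w' h => ?_) i j ?_
    · rwa [← adj_iff]
    · rw [← hYP]
      refine h2 i w ?_
      rwa [← adj_iff]
    · have := h3 w w' (by rwa [← adj_iff])
      rw [Matrix.mul_assoc, mul_apply] at this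
      simpa only [hPw, hYP] using this
    · rwa [adj_iff]

/-- A nullity attained on `G` is attained on `G₁` if the other vertices can be eliminated. -/
theorem isNullity_reduce {k : ℕ} (hV : V(G₁.graph) ⊆ V(G.graph)) [Fintype V(G.graph)]
    {A : Matrix V(G.graph) V(G.graph) ℝ}
    (hA : Realizes (fun i j : V(G.graph) => G.EvenAdj i j)
      (fun i j : V(G.graph) => G.OddAdj i j) A k)
    (hD : (A.submatrix (Set.inclusion (Set.sdiff_subset (t := V(G₁.graph))))
      (Set.inclusion Set.sdiff_subset)).PosDef)
    (τ : Set α)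
    (hτ : ∀ x ∈ V(G₁.graph), ∀ w ∈ V(G.graph) \ V(G₁.graph), G.graph.Adj x w → x ∈ τ)
    (hclique : ∀ x ∈ V(G₁.graph), ∀ y ∈ V(G₁.graph), x ∈ τ → y ∈ τ → G₁.graph.Adj x y ∨ x = y)
    (hadj : ∀ x ∈ V(G₁.graph), ∀ y ∈ V(G₁.graph), G.graph.Adj x y → G₁.graph.Adj x y)
    (hpat : ∀ (D : Matrix ↥(V(G.graph) \ V(G₁.graph)) ↥(V(G.graph) \ V(G₁.graph)) ℝ)
      (m : α → α → ℝ), Gadget G D m → SignPattern (fun i j : V(G₁.graph) => G₁.EvenAdj i j)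
        (fun i j : V(G₁.graph) => G₁.OddAdj i j) (fun i j => m i j + fill D m i j)) :
    G₁.IsNullity k := by
  classical
  let m : α → α → ℝ := fun x y =>
    if h : x ∈ V(G.graph) ∧ y ∈ V(G.graph) then A ⟨x, h.1⟩ ⟨y, h.2⟩ else 0
  have hmA : ∀ i j : V(G.graph), m i j = A i j := fun i j => dif_pos ⟨i.2, j.2⟩
  set D := A.submatrix (Set.inclusion (Set.sdiff_subset (t := V(G₁.graph))))
      (Set.inclusion Set.sdiff_subset) with hDdef
  have hDm : ∀ i j, D i j = m i j := fun i j => (hmA ⟨i, i.2.1⟩ ⟨j, j.2.1⟩).symm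
  have hg : Gadget G D m := by
    refine ⟨hD, fun x y => ?_, fun x y hxy => ?_, fun i j _ => hDm i j⟩
    · simp only [m, and_comm (a := x ∈ V(G.graph))]
      split_ifs with h
      · exact hA.isSymm.apply _ _
      · rfl
    · by_cases h : x ∈ V(G.graph) ∧ y ∈ V(G.graph)
      · simp only [m, dif_pos h]
        exact hA.pattern ⟨x, h.1⟩ ⟨y, h.2⟩ (fun h => hxy (congrArg Subtype.val h))
      · have : ¬ (G.EvenAdj x y ∨ G.OddAdj x y) := by
          rw [← adj_iff]
          exact fun hadj => h ⟨hadj.left_mem, hadj.right_mem⟩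
        rw [not_or] at this
        refine ⟨fun h => absurd h this.1, fun h => absurd h this.2, fun _ => dif_neg h⟩
  have hpat := hpat D m hg
  let e := Equiv.Set.sumDiffSubset hV
  have he : ∀ i, ((e i : V(G.graph)) : α) = Sum.elim Subtype.val Subtype.val i := by
    rintro (i | i) <;> simp [e]
  have hA' := hA.submatrix e
  let B : Matrix V(G₁.graph) ↥(V(G.graph) \ V(G₁.graph)) ℝ := of fun n w => m n w
  have hblock : A.submatrix e e = fromBlocks (of fun i j : V(G₁.graph) => m i j) B Bᵀ D := by
    ext i j
    rw [submatrix_apply, ← hmA, he, he]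
    rcases i with i | i <;> rcases j with j | j
    · rfl
    · rfl
    · exact hg.comm _ _
    · exact (hDm i j).symm
  rw [hblock] at hA'
  simp only [he] at hA'
  have hS : ∀ i j, (of (fun i j : V(G₁.graph) => m i j) - B * D⁻¹ * Bᵀ) i j =
      m i j + fill D m i j := by
    intro i j
    rw [Matrix.sub_apply, mul_inv_mul_transpose_apply, sub_neg_eq_add]
    rfl
  have := hA'.schur (ev' := fun i j : V(G₁.graph) => G₁.EvenAdj i j)
    (od' := fun i j : V(G₁.graph) => G₁.OddAdj i j) hD (fun n => (n : α) ∈ τ)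
    (fun n w hn h => hn (hτ n n.2 w w.2 ((adj_iff _ _ _).2 h)))
    (fun n w hn h => hn (hτ n n.2 w w.2 ((adj_iff _ _ _).2 h).symm))
    (fun n n' hn hn' => by
      rw [← adj_iff]
      exact (hclique n n.2 n' n'.2 hn hn').imp_right Subtype.ext)
    (fun n n' h => by
      rw [← adj_iff]
      exact hadj n n.2 n' n'.2 ((adj_iff _ _ _).2 h))
    (fun i j hij => by rw [hS]; exact hpat i j hij)
  have h1 : k ∈ G₁.nullities := (mem_nullities_iff G₁ k).2 ⟨_, this⟩
  unfold IsNullity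
  convert h1

end Transfer

/-! ### Kernel vectors supported on a side -/

/-- A nonzero vector on which the form of the block is nonpositive, extended by zero, is isotropic
for the semidefinite `A`, hence in its kernel. -/
theorem exists_kernel_vector {V W : Type*} [Fintype V] [Fintype W] {A : Matrix V V ℝ}
    (hA : A.PosSemidef) {f : W → V} (hf : Function.Injective f)
    (h : ¬ (A.submatrix f f).PosDef) :
    ∃ x : V → ℝ, x ≠ 0 ∧ (∀ i, i ∉ Set.range f → x i = 0) ∧ A *ᵥ x = 0 := by
  classical
  have hpsd := hA.submatrix f
  obtain ⟨y, hy, hle⟩ : ∃ y : W → ℝ, y ≠ 0 ∧ y ⬝ᵥ (A.submatrix f f) *ᵥ y ≤ 0 := by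
    by_contra hcon
    push Not at hcon
    exact h (posDef_iff_dotProduct_mulVec.2 ⟨hpsd.isHermitian, fun x hx => by
      rw [star_trivial]; exact hcon x hx⟩)
  let x : V → ℝ := Function.extend f y 0
  have hx : ∀ w, x (f w) = y w := fun w => hf.extend_apply _ _ _
  have hx0 : ∀ i, i ∉ Set.range f → x i = 0 := fun i hi =>
    Function.extend_apply' _ _ _ hi
  refine ⟨x, ?_, hx0, ?_⟩
  · intro h0
    apply hy
    ext w
    rw [← hx, h0]; rfl
  · rw [← hA.dotProduct_mulVec_zero_iff, star_trivial]
    have h1 : x ⬝ᵥ A *ᵥ x = y ⬝ᵥ (A.submatrix f f) *ᵥ y := by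
      symm
      refine Fintype.sum_of_injective f hf _ _ (fun i hi => by rw [hx0 i hi, zero_mul]) fun w => ?_
      rw [hx]
      congr 1
      refine Fintype.sum_of_injective f hf _ _ (fun i hi => by simp only [hx0 i hi, mul_zero])
        fun w' => ?_
      simp only [hx, submatrix_apply]
    refine le_antisymm (h1 ▸ hle) ?_
    have := (posSemidef_iff_dotProduct_mulVec.1 hA).2 x
    rwa [star_trivial] at this

/-- Two mutually nonadjacent sets of vertices cannot both carry singular blocks, except for
an isolated vertex that spans the kernel. -/
theorem Realizes.posDef_or {V W₁ W₂ : Type*} [Fintype V] [Fintype W₁] [Fintype W₂]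
    {ev od : V → V → Prop} {A : Matrix V V ℝ} {k : ℕ} (hA : Realizes ev od A k)
    {f₁ : W₁ → V} {f₂ : W₂ → V} (h₁ : Function.Injective f₁) (h₂ : Function.Injective f₂)
    (hsymm : ∀ i j, ev i j ∨ od i j → ev j i ∨ od j i)
    (hadj : ∀ i j, ¬ (ev (f₁ i) (f₂ j) ∨ od (f₁ i) (f₂ j)))
    (hiso : ∀ i j, f₁ i = f₂ j → ∀ l, ¬ (ev (f₁ i) l ∨ od (f₁ i) l)) :
    (A.submatrix f₁ f₁).PosDef ∨ (A.submatrix f₂ f₂).PosDef ∨ k = 1 := by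
  classical
  by_contra hcon
  push Not at hcon
  obtain ⟨hn₁, hn₂, hk⟩ := hcon
  obtain ⟨x, hx, hxs, hAx⟩ := exists_kernel_vector hA.posSemidef h₁ hn₁
  obtain ⟨y, hy, hys, hAy⟩ := exists_kernel_vector hA.posSemidef h₂ hn₂
  -- The SAP applied to $ab^T+ba^T$.
  have hsap : ∀ a b : V → ℝ, A *ᵥ a = 0 → A *ᵥ b = 0 → (∀ i, a i * b i = 0) →
      (∀ i j, ev i j ∨ od i j → a i * b j = 0) → ∀ i j, a i * b j + b i * a j = 0 := by
    intro a b ha hb hd hab i j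
    have := hA.sap (vecMulVec a b + vecMulVec b a) ?_ ?_ ?_
    · exact congrFun (congrFun this i) j
    · unfold IsSymm
      rw [transpose_add, transpose_vecMulVec, transpose_vecMulVec, add_comm]
    · rintro i j (hij | rfl)
      · have h1 := hab i j hij
        have h2 := hab j i (hsymm i j hij)
        simp only [Matrix.add_apply, vecMulVec_apply]
        linarith
      · have := hd i
        simp only [Matrix.add_apply, vecMulVec_apply]
        linarith
    · rw [Matrix.mul_add, mul_vecMulVec, mul_vecMulVec, ha, hb]
      simp
  by_cases hdiag : ∀ i, x i * y i = 0
  · have h := hsap x y hAx hAy hdiag (fun i j hij => by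
      by_cases hi : i ∈ Set.range f₁
      · by_cases hj : j ∈ Set.range f₂
        · obtain ⟨a, rfl⟩ := hi
          obtain ⟨b, rfl⟩ := hj
          exact absurd hij (hadj a b)
        · rw [hys j hj, mul_zero]
      · rw [hxs i hi, zero_mul])
    obtain ⟨a, ha⟩ := Function.ne_iff.1 hx
    obtain ⟨b, hb⟩ := Function.ne_iff.1 hy
    have h3 : y a = 0 := (mul_eq_zero.1 (hdiag a)).resolve_left ha
    have h4 := h a b
    rw [h3, zero_mul, add_zero] at h4
    exact (mul_ne_zero ha hb) h4
  -- A common support vertex is isolated with zero diagonal entry, so its unit vector lies in the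
  -- kernel. Subtracting a multiple of it from any kernel vector leaves disjoint supports, and
  -- `hsap` makes the remainder zero.
  · push Not at hdiag
    obtain ⟨i, hi⟩ := hdiag
    have hi₁ : i ∈ Set.range f₁ := by
      by_contra h; rw [hxs i h, zero_mul] at hi; exact hi rfl
    have hi₂ : i ∈ Set.range f₂ := by
      by_contra h; rw [hys i h, mul_zero] at hi; exact hi rfl
    obtain ⟨a, rfl⟩ := hi₁
    obtain ⟨b, hb⟩ := hi₂
    have hisol := hiso a b hb.symm
    have hrow : ∀ l, f₁ a ≠ l → A (f₁ a) l = 0 := fun l hl =>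
      (hA.pattern _ _ hl).2.2 (hisol l)
    have hii : A (f₁ a) (f₁ a) = 0 := by
      have h1 : ∑ l, A (f₁ a) l * x l = 0 := congrFun hAx (f₁ a)
      rw [Finset.sum_eq_single (f₁ a) (fun l _ hl => by rw [hrow l hl.symm, zero_mul])
        (fun h => absurd (Finset.mem_univ _) h)] at h1
      exact (mul_eq_zero.1 h1).resolve_right (left_ne_zero_of_mul hi)
    have hrow' : ∀ l, A (f₁ a) l = 0 := fun l => by
      by_cases hl : f₁ a = l
      · rw [← hl, hii]
      · exact hrow l hl
    have hker : A *ᵥ (Pi.single (f₁ a) 1) = 0 := by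
      ext l
      rw [mulVec_single_one, col_apply, ← hA.isSymm.apply, hrow']
      rfl
    apply hk
    rw [← hA.nullity]
    have hmem : (Pi.single (f₁ a) 1 : V → ℝ) ∈ LinearMap.ker A.mulVecLin := by
      rw [LinearMap.mem_ker, mulVecLin_apply, hker]
    refine (finrank_eq_one_iff_of_nonzero' ⟨_, hmem⟩ ?_).2 ?_
    · intro h
      have := congrFun (congrArg Subtype.val h) (f₁ a)
      simp at this
    · rintro ⟨z, hz⟩
      rw [LinearMap.mem_ker, mulVecLin_apply] at hz
      have h := hsap (Pi.single (f₁ a) 1) (z - z (f₁ a) • Pi.single (f₁ a) 1) hker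
        (by rw [mulVec_sub, mulVec_smul, hz, hker, smul_zero, sub_zero])
        (fun l => by
          by_cases hl : l = f₁ a
          · subst hl; simp
          · simp [hl])
        (fun l l' hll => by
          by_cases hl : l = f₁ a
          · subst hl; exact absurd hll (hisol l')
          · simp [hl])
      refine ⟨z (f₁ a), Subtype.ext ?_⟩
      ext l
      by_cases hl : l = f₁ a
      · subst hl; simp
      · have := h (f₁ a) l
        simp [hl] at this
        simp [hl, this]

/-- A signed graph with at least one vertex attains the nullity `1`. -/
theorem isNullity_one [Finite α] {G : SignedGraph α β} {s : α} (hs : s ∈ V(G.graph)) :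
    G.IsNullity 1 := by
  classical
  -- A single vertex with the zero matrix has nullity 1; it is extended to `G` by a dominant block
  -- on the other vertices.
  let G₁ : SignedGraph α β :=
    ⟨Graph.noEdge {s} β, ⟨fun e x h => by simp at h⟩, ∅, Set.empty_subset _⟩
  have hV : V(G₁.graph) = {s} := rfl
  have hsub : ∀ i j : V(G₁.graph), i = j := fun i j => Subtype.ext (i.2.trans j.2.symm)
  have hno : ∀ x y, ¬ G₁.graph.Adj x y := fun x y ⟨e, h⟩ => by simp [G₁] at h
  let : Fintype V(G₁.graph) := Fintype.ofFinite _
  let : Fintype ↥(V(G.graph) \ V(G₁.graph)) := Fintype.ofFinite _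
  have hcard : Fintype.card V(G₁.graph) = 1 :=
    Fintype.card_eq_one_iff.2 ⟨⟨s, rfl⟩, fun j => hsub j _⟩
  refine isNullity_extend (G₁ := G₁) (H := G) (S := 0) (D := dominantMatrix _ G.unitWeight)
    (m := G.unitWeight) (by rw [hV]; exact Set.singleton_subset_iff.2 hs) ?_
    (gadget_dominantMatrix G.unitWeight_comm G.abs_unitWeight_le G.unitWeight_pattern)
    (fun _ _ _ => Iff.rfl) (fun _ _ _ => Iff.rfl) (fun i j hij => absurd (hsub i j) hij)
    (fun _ _ _ _ _ i j h => absurd h (hno i j))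
  refine ⟨isSymm_zero, fun i j hij => absurd (hsub i j) hij, PosSemidef.zero, ?_, ?_⟩
  · intro X _ hz _
    ext i j
    exact hz i j (Or.inr (hsub i j))
  · rw [mulVecLin_zero, LinearMap.ker_zero, finrank_top, Module.finrank_fintype_fun_eq_card, hcard]

end SignedGraph

namespace SignedGraph

open Matrix

variable {α β : Type*}

/-! ### Sides of an edge partition -/

theorem ofEdges_evenAdj {G : SignedGraph α β} {F : Set β} {x y : α} :
    (G.ofEdges F).EvenAdj x y ↔ ∃ e ∈ F, e ∉ G.odd ∧ G.graph.IsLink e x y := by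
  constructor
  · rintro ⟨e, h1, h2, h3⟩
    exact ⟨e, h2, fun h => h1 ⟨h2, h⟩, h3⟩
  · rintro ⟨e, h1, h2, h3⟩
    exact ⟨e, fun h => h2 h.2, h1, h3⟩

theorem ofEdges_oddAdj {G : SignedGraph α β} {F : Set β} {x y : α} :
    (G.ofEdges F).OddAdj x y ↔ ∃ e ∈ F, e ∈ G.odd ∧ G.graph.IsLink e x y := by
  constructor
  · rintro ⟨e, h1, h2, h3⟩
    exact ⟨e, h2, h1.2, h3⟩
  · rintro ⟨e, h1, h2, h3⟩
    exact ⟨e, ⟨h1, h2⟩, h1, h3⟩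

theorem EvenAdj.adj {G : SignedGraph α β} {x y : α} (h : G.EvenAdj x y) : G.graph.Adj x y :=
  (G.adj_iff x y).2 (Or.inl h)

theorem OddAdj.adj {G : SignedGraph α β} {x y : α} (h : G.OddAdj x y) : G.graph.Adj x y :=
  (G.adj_iff x y).2 (Or.inr h)

namespace EdgePartition

variable {G : SignedGraph α β} (S : EdgePartition G)

/-- The edge partition with its classes exchanged. -/
def swap : EdgePartition G where
  E₁ := S.E₂
  E₂ := S.E₁
  nonempty₁ := S.nonempty₂
  nonempty₂ := S.nonempty₁
  disjoint := S.disjoint.symm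
  union_eq := by rw [Set.union_comm, S.union_eq]

theorem mem_or_mem {e : β} {x y : α} (h : G.graph.IsLink e x y) : e ∈ S.E₁ ∨ e ∈ S.E₂ := by
  have := h.edge_mem
  rwa [← S.union_eq] at this

theorem evenAdj_iff (x y : α) :
    G.EvenAdj x y ↔ S.side₁.EvenAdj x y ∨ S.side₂.EvenAdj x y := by
  rw [side₁, side₂, ofEdges_evenAdj, ofEdges_evenAdj]
  constructor
  · rintro ⟨e, he, h⟩
    exact (S.mem_or_mem h).imp (fun h' => ⟨e, h', he, h⟩) (fun h' => ⟨e, h', he, h⟩)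
  · rintro (⟨e, -, he, h⟩ | ⟨e, -, he, h⟩) <;> exact ⟨e, he, h⟩

theorem oddAdj_iff (x y : α) :
    G.OddAdj x y ↔ S.side₁.OddAdj x y ∨ S.side₂.OddAdj x y := by
  rw [side₁, side₂, ofEdges_oddAdj, ofEdges_oddAdj]
  constructor
  · rintro ⟨e, he, h⟩
    exact (S.mem_or_mem h).imp (fun h' => ⟨e, h', he, h⟩) (fun h' => ⟨e, h', he, h⟩)
  · rintro (⟨e, -, he, h⟩ | ⟨e, -, he, h⟩) <;> exact ⟨e, he, h⟩

theorem adj_iff_or (x y : α) :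
    G.graph.Adj x y ↔ S.side₁.graph.Adj x y ∨ S.side₂.graph.Adj x y := by
  rw [adj_iff, adj_iff, adj_iff, S.evenAdj_iff, S.oddAdj_iff]
  tauto

theorem side₁_subset : V(S.side₁.graph) ⊆ V(G.graph) := by
  rintro x ⟨e, -, h⟩
  exact h.vertex_mem

theorem side₁_nonempty : V(S.side₁.graph).Nonempty := by
  obtain ⟨e, he⟩ := S.nonempty₁
  have : e ∈ E(G.graph) := by rw [← S.union_eq]; exact Or.inl he
  obtain ⟨x, y, h⟩ := Graph.exists_isLink_of_mem_edgeSet this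
  exact ⟨x, e, he, y, h⟩

theorem evenAdj_of_notMem {x w : α} (hw : w ∉ V(S.side₁.graph)) :
    G.EvenAdj x w ↔ S.side₂.EvenAdj x w := by
  rw [S.evenAdj_iff]
  exact or_iff_right fun h => hw h.adj.right_mem

theorem oddAdj_of_notMem {x w : α} (hw : w ∉ V(S.side₁.graph)) :
    G.OddAdj x w ↔ S.side₂.OddAdj x w := by
  rw [S.oddAdj_iff]
  exact or_iff_right fun h => hw h.adj.right_mem

theorem adj_of_notMem {x w : α} (hw : w ∉ V(S.side₁.graph)) :
    G.graph.Adj x w ↔ S.side₂.graph.Adj x w := by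
  rw [S.adj_iff_or]
  exact or_iff_right fun h => hw h.right_mem

/-- The second side joins no two vertices of the first side, unless both are common. -/
theorem side₂_not_adj {x y : α} (hx : x ∈ V(S.side₁.graph)) (hy : y ∈ V(S.side₁.graph))
    (h : x ∉ S.common ∨ y ∉ S.common) : ¬ S.side₂.graph.Adj x y := fun hadj =>
  h.elim (fun h => h ⟨hx, hadj.left_mem⟩) (fun h => h ⟨hy, hadj.right_mem⟩)

/-- Eliminating vertices of the second side only affects entries between common vertices. -/
theorem fill_eq_zero {m : α → α → ℝ} {W : Set α} [Fintype W] [DecidableEq W]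
    {D : Matrix W W ℝ} (hD : D.PosDef) (hW : ∀ w ∈ W, w ∉ V(S.side₁.graph))
    (hm : ∀ x, ∀ w ∈ W, x ≠ w → ¬ S.side₂.graph.Adj x w → m x w = 0) {x y : α}
    (hx : x ∈ V(S.side₁.graph)) (hy : y ∈ V(S.side₁.graph))
    (h : x ∉ S.common ∨ y ∉ S.common) : fill D m x y = 0 := by
  have key : ∀ {x y : α}, x ∈ V(S.side₁.graph) → x ∉ S.common → fill D m x y = 0 := by
    intro x y hx hx'
    refine Finset.sum_eq_zero fun w _ => ?_
    have hmw := hm x w w.2 (fun h => hW w w.2 (h ▸ hx)) fun hadj => hx' ⟨hx, hadj.left_mem⟩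
    simp only [hmw, zero_mul]
  rcases h with h | h
  · exact key hx h
  · rw [fill_comm hD]; exact key hy h

theorem potential_eq_zero {m : α → α → ℝ} {W : Set α} [Fintype W] [DecidableEq W]
    {D : Matrix W W ℝ} (hW : ∀ w ∈ W, w ∉ V(S.side₁.graph))
    (hm : ∀ x, ∀ w ∈ W, x ≠ w → ¬ S.side₂.graph.Adj x w → m x w = 0) {x : α}
    (hx : x ∈ V(S.side₁.graph)) (h : x ∉ S.common) : potential D m x = 0 := by
  have : (-fun i : W => m x i) = 0 := by
    ext w
    have hmw := hm x w w.2 (fun h => hW w w.2 (h ▸ hx)) fun hadj => h ⟨hx, hadj.left_mem⟩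
    simp only [Pi.neg_apply, hmw, neg_zero, Pi.zero_apply]
  rw [potential, this, mulVec_zero]

theorem gadget_eq_zero {m : α → α → ℝ} {W : Set α} {D : Matrix W W ℝ} (hg : Gadget G D m)
    (hW : ∀ w ∈ W, w ∉ V(S.side₁.graph)) :
    ∀ x, ∀ w ∈ W, x ≠ w → ¬ S.side₂.graph.Adj x w → m x w = 0 := by
  intro x w hw hne hadj
  refine (hg.pattern x w hne).2.2 ?_
  rw [← adj_iff, S.adj_of_notMem (hW w hw)]
  exact hadj

/-- Unless the nullity is `1`, the block off one of the sides is positive definite. -/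
theorem posDef_or [Finite α] [Fintype V(G.graph)] {A : Matrix V(G.graph) V(G.graph) ℝ} {k : ℕ}
    (hA : Realizes (fun i j : V(G.graph) => G.EvenAdj i j)
      (fun i j : V(G.graph) => G.OddAdj i j) A k) :
    (A.submatrix (Set.inclusion (Set.sdiff_subset (t := V(S.side₁.graph))))
      (Set.inclusion Set.sdiff_subset)).PosDef ∨
    (A.submatrix (Set.inclusion (Set.sdiff_subset (t := V(S.side₂.graph))))
      (Set.inclusion Set.sdiff_subset)).PosDef ∨ k = 1 := by
  let : Fintype ↥(V(G.graph) \ V(S.side₁.graph)) := Fintype.ofFinite _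
  let : Fintype ↥(V(G.graph) \ V(S.side₂.graph)) := Fintype.ofFinite _
  refine hA.posDef_or (Set.inclusion_injective _) (Set.inclusion_injective _) ?_ ?_ ?_
  · rintro i j (h | h)
    · exact Or.inl h.symm
    · exact Or.inr h.symm
  · intro i j h
    have h1 : G.graph.Adj i j := (adj_iff _ _ _).2 h
    rcases (S.adj_iff_or _ _).1 h1 with h2 | h2
    · exact i.2.2 h2.left_mem
    · exact j.2.2 h2.right_mem
  · intro i j hij l h
    have h1 : G.graph.Adj i l := (adj_iff _ _ _).2 h
    have hij' : (i : α) = j := congrArg Subtype.val hij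
    rcases (S.adj_iff_or _ _).1 h1 with h2 | h2
    · exact i.2.2 h2.left_mem
    · exact j.2.2 (hij' ▸ h2.left_mem)

/-! ### Splits with at most one common vertex -/

/-- With at most one common vertex, the gadget alters at most a diagonal entry, on which nothing is
imposed. -/
theorem isNullity_of_side₁ [Finite α] (hS : S.common.Subsingleton) {k : ℕ}
    (h : S.side₁.IsNullity k) : G.IsNullity k := by
  classical
  let : Fintype V(S.side₁.graph) := Fintype.ofFinite _
  let : Fintype ↥(V(G.graph) \ V(S.side₁.graph)) := Fintype.ofFinite _
  obtain ⟨A, hA⟩ := (mem_nullities_iff S.side₁ k).1 h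
  have hg := gadget_dominantMatrix (W := V(G.graph) \ V(S.side₁.graph)) G.unitWeight_comm
    G.abs_unitWeight_le G.unitWeight_pattern
  have hne : ∀ i j : V(S.side₁.graph), i ≠ j → (i : α) ∉ S.common ∨ (j : α) ∉ S.common := by
    intro i j hij
    by_contra hcon
    push Not at hcon
    exact hij (Subtype.ext (hS hcon.1 hcon.2))
  refine isNullity_extend S.side₁_subset hA hg (fun _ _ _ => Iff.rfl) (fun _ _ _ => Iff.rfl) ?_ ?_
  · intro i j hij
    have h2 := S.side₂_not_adj i.2 j.2 (hne i j hij)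
    have h3 : G.EvenAdj i j ↔ S.side₁.EvenAdj i j := by
      rw [S.evenAdj_iff]; exact or_iff_left fun h => h2 h.adj
    have h4 : G.OddAdj i j ↔ S.side₁.OddAdj i j := by
      rw [S.oddAdj_iff]; exact or_iff_left fun h => h2 h.adj
    simp only [h3, h4]
    rw [S.fill_eq_zero hg.posDef (fun w hw => hw.2) (S.gadget_eq_zero hg fun w hw => hw.2) i.2 j.2
      (hne i j hij), sub_zero]
    exact hA.pattern i j hij
  · intro Y _ h1 _ _ i j hij
    exact h1 i j (Or.inl ((S.adj_iff_or _ _).2 (Or.inl hij)))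

theorem side₁_isNullity [Finite α] (hS : S.common.Subsingleton) {k : ℕ} [Fintype V(G.graph)]
    {A : Matrix V(G.graph) V(G.graph) ℝ}
    (hA : Realizes (fun i j : V(G.graph) => G.EvenAdj i j)
      (fun i j : V(G.graph) => G.OddAdj i j) A k)
    (hD : (A.submatrix (Set.inclusion (Set.sdiff_subset (t := V(S.side₁.graph))))
      (Set.inclusion Set.sdiff_subset)).PosDef) : S.side₁.IsNullity k := by
  classical
  let : Fintype V(S.side₁.graph) := Fintype.ofFinite _
  let : Fintype ↥(V(G.graph) \ V(S.side₁.graph)) := Fintype.ofFinite _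
  have hne : ∀ i j : V(S.side₁.graph), i ≠ j → (i : α) ∉ S.common ∨ (j : α) ∉ S.common := by
    intro i j hij
    by_contra hcon
    push Not at hcon
    exact hij (Subtype.ext (hS hcon.1 hcon.2))
  refine isNullity_reduce S.side₁_subset hA hD S.common ?_ ?_ ?_ ?_
  · intro x hx w hw hadj
    exact ⟨hx, ((S.adj_of_notMem hw.2).1 hadj).left_mem⟩
  · intro x _ y _ hx hy
    exact Or.inr (hS hx hy)
  · intro x hx y hy hadj
    have hxy : x ≠ y := by
      rintro rfl
      obtain ⟨e, he⟩ := hadj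
      have := G.loopless
      exact G.graph.not_isLoopAt e x he
    exact ((S.adj_iff_or _ _).1 hadj).resolve_right
      (S.side₂_not_adj hx hy (hne ⟨x, hx⟩ ⟨y, hy⟩ (fun h => hxy (congrArg Subtype.val h))))
  · intro D m hg i j hij
    have h2 := S.side₂_not_adj i.2 j.2 (hne i j hij)
    have h3 : G.EvenAdj i j ↔ S.side₁.EvenAdj i j := by
      rw [S.evenAdj_iff]; exact or_iff_left fun h => h2 h.adj
    have h4 : G.OddAdj i j ↔ S.side₁.OddAdj i j := by
      rw [S.oddAdj_iff]; exact or_iff_left fun h => h2 h.adj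
    simp only [← h3, ← h4]
    rw [S.fill_eq_zero hg.posDef (fun w hw => hw.2) (S.gadget_eq_zero hg fun w hw => hw.2) i.2 j.2
      (hne i j hij), add_zero]
    exact hg.pattern i j (fun h => hij (Subtype.ext h))

theorem isNullity_iff [Finite α] (hS : S.common.Subsingleton) (k : ℕ) :
    G.IsNullity k ↔ S.side₁.IsNullity k ∨ S.side₂.IsNullity k := by
  have hS' : S.swap.common.Subsingleton := by
    have : S.swap.common = S.common := Set.inter_comm _ _
    rwa [this]
  constructor
  · intro h
    let : Fintype V(G.graph) := Fintype.ofFinite _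
    obtain ⟨A, hA⟩ := (mem_nullities_iff G k).1 h
    rcases S.posDef_or hA with hD | hD | rfl
    · exact Or.inl (S.side₁_isNullity hS hA hD)
    · exact Or.inr (S.swap.side₁_isNullity hS' hA hD)
    · exact Or.inl (isNullity_one S.side₁_nonempty.some_mem)
  · rintro (h | h)
    · exact S.isNullity_of_side₁ hS h
    · exact S.swap.isNullity_of_side₁ hS' h

end EdgePartition

end SignedGraph

namespace SignedGraph

open Matrix

variable {α β : Type*}

/-! ### The parts of a 2-split -/

theorem addEdges_evenAdj {H : SignedGraph α β} {u v : α} {huv : u ≠ v} {hu : u ∈ V(H.graph)}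
    {hv : v ∈ V(H.graph)} {T : Set Bool} {x y : α} :
    (H.addEdges u v huv hu hv T).EvenAdj x y ↔
      H.EvenAdj x y ∨ false ∈ T ∧ ((x = u ∧ y = v) ∨ (x = v ∧ y = u)) := by
  constructor
  · rintro ⟨e | b, he, h⟩
    · exact Or.inl ⟨e, fun ho => he (Or.inl ⟨e, ho, rfl⟩), h⟩
    · cases b
      · exact Or.inr h
      · exact absurd (Or.inr ⟨true, ⟨h.1, rfl⟩, rfl⟩) he
  · rintro (⟨e, he, h⟩ | h)
    · refine ⟨Sum.inl e, ?_, h⟩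
      rintro (⟨e', he', h'⟩ | ⟨b, -, h'⟩)
      · exact he (Sum.inl_injective h' ▸ he')
      · simp at h'
    · refine ⟨Sum.inr false, ?_, h⟩
      rintro (⟨e', he', h'⟩ | ⟨b, ⟨-, hb⟩, h'⟩)
      · simp at h'
      · rw [Set.mem_singleton_iff] at hb
        subst hb
        simp at h'

theorem addEdges_oddAdj {H : SignedGraph α β} {u v : α} {huv : u ≠ v} {hu : u ∈ V(H.graph)}
    {hv : v ∈ V(H.graph)} {T : Set Bool} {x y : α} :
    (H.addEdges u v huv hu hv T).OddAdj x y ↔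
      H.OddAdj x y ∨ true ∈ T ∧ ((x = u ∧ y = v) ∨ (x = v ∧ y = u)) := by
  constructor
  · rintro ⟨e | b, he, h⟩
    · rcases he with ⟨e', he', h'⟩ | ⟨b, -, h'⟩
      · exact Or.inl ⟨e, Sum.inl_injective h' ▸ he', h⟩
      · simp at h'
    · rcases he with ⟨e', he', h'⟩ | ⟨b', ⟨-, hb⟩, h'⟩
      · simp at h'
      · rw [Set.mem_singleton_iff] at hb
        subst hb
        obtain rfl := Sum.inr_injective h'
        exact Or.inr h
  · rintro (⟨e, he, h⟩ | h)
    · exact ⟨Sum.inl e, Or.inl ⟨e, he, rfl⟩, h⟩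
    · exact ⟨Sum.inr true, Or.inr ⟨true, ⟨h.1, rfl⟩, rfl⟩, h⟩

/-- A path that uses a direct edge consists of it alone, so that edge would be odd. -/
theorem HasOddPath.hasIndirectPath {H : SignedGraph α β} {u v : α} (h : H.HasOddPath u v)
    (hno : ¬ H.OddAdj u v) : HasIndirectPath H u v (-1) := by
  obtain ⟨p, hp, ho⟩ := h
  refine ⟨p, hp, fun e he hl => hno ⟨e, ?_, hl⟩, ho.neg_one_pow⟩
  by_contra hne
  rw [Walk.oddCount, hp.edges_eq_singleton he hl.symm] at ho
  simp [hne] at ho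

theorem HasEvenPath.hasIndirectPath {H : SignedGraph α β} {u v : α} (h : H.HasEvenPath u v)
    (hno : ¬ H.EvenAdj u v) : HasIndirectPath H u v 1 := by
  obtain ⟨p, hp, ho⟩ := h
  refine ⟨p, hp, fun e he hl => hno ⟨e, fun hne => ?_, hl⟩, ho.neg_one_pow⟩
  rw [Walk.oddCount, hp.edges_eq_singleton he hl.symm] at ho
  simp [hne] at ho

theorem IsConnected.hasOddPath_or {H : SignedGraph α β} (hc : H.IsConnected) {u v : α}
    (hu : u ∈ V(H.graph)) (hv : v ∈ V(H.graph)) : H.HasOddPath u v ∨ H.HasEvenPath u v := by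
  obtain ⟨p, hp⟩ := (hc.2 u hu v hv).some.exists_isPath
  exact (Nat.even_or_odd p.oddCount).symm.imp (fun h => ⟨p, hp, h⟩) (fun h => ⟨p, hp, h⟩)

/-- The sign condition for a single entry. -/
def SignCond (ev od : Prop) (a : ℝ) : Prop :=
  (ev → ¬ od → a < 0) ∧ (od → ¬ ev → 0 < a) ∧ (¬ (ev ∨ od) → a = 0)

/-- A gadget for a side whose contribution `fill` turns the entry `c` into `c - fill`. -/
theorem exists_gadget_signCond {H : SignedGraph α β} {W : Set α} [Fintype W] [DecidableEq W]
    {u v : α} (hW : V(H.graph) ⊆ W ∪ {u, v}) (huv : u ≠ v) (hu : u ∉ W) (hv : v ∉ W)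
    (hc : H.IsConnected) (hpar : ¬ H.IsBipartite → H.HasOddPath u v ∧ H.HasEvenPath u v)
    (huH : u ∈ V(H.graph)) (hvH : v ∈ V(H.graph)) {ev od : Prop} {c : ℝ}
    (hsc : SignCond (ev ∨ false ∈ H.replacementSigns u v) (od ∨ true ∈ H.replacementSigns u v) c) :
    ∃ (D : Matrix W W ℝ) (m : α → α → ℝ), Gadget H D m ∧
      SignCond (ev ∨ H.EvenAdj u v) (od ∨ H.OddAdj u v) (c - fill D m u v) ∧
      ((ev ∨ H.EvenAdj u v) ∨ (od ∨ H.OddAdj u v) ∨ Nondegenerate H D m u v) := by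
  -- Without an odd path the side is bipartite by `hpar` and its replacement is a single even edge,
  -- so the sign of `c` is already right. `hpos` is the mirror statement.
  have hneg : ¬ H.HasOddPath u v → ¬ od → c < 0 := by
    intro h hod
    have hb : H.IsBipartite := by
      by_contra hb
      exact h (hpar hb).1
    refine hsc.1 (Or.inr (Or.inr ?_)) ?_
    · simpa using h
    · rintro (h' | h' | h')
      · exact hod h'
      · exact h' hb
      · exact h (h'.1 rfl)
  have hpos : ¬ H.HasEvenPath u v → ¬ ev → 0 < c := by
    intro h hev
    have hb : H.IsBipartite := by
      by_contra hb
      exact h (hpar hb).2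
    have hodd := (hc.hasOddPath_or huH hvH).resolve_right h
    refine hsc.2.1 (Or.inr (Or.inr ?_)) ?_
    · simpa using hodd
    · rintro (h' | h' | h')
      · exact hev h'
      · exact h' hb
      · exact absurd (h'.2 hodd) (by decide)
  by_cases hev : ev ∨ H.EvenAdj u v <;> by_cases hod : od ∨ H.OddAdj u v
  · obtain ⟨D, m, hg, -⟩ := exists_gadget_small H W u v one_pos
    exact ⟨D, m, hg, ⟨fun _ h => absurd hod h, fun _ h => absurd hev h,
      fun h => absurd (Or.inl hev) h⟩, Or.inl hev⟩
  · rw [not_or] at hod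
    suffices h : ∃ (D : Matrix W W ℝ) (m : α → α → ℝ), Gadget H D m ∧ c < fill D m u v by
      obtain ⟨D, m, hg, hf⟩ := h
      exact ⟨D, m, hg, ⟨fun _ _ => by linarith, fun _ h => absurd hev h,
        fun h => absurd (Or.inl hev) h⟩, Or.inl hev⟩
    -- An odd path lets `fill` exceed `c`; otherwise `c` is negative and a small `fill` suffices.
    by_cases hodd : H.HasOddPath u v
    · have hpos' : 0 < |c| + 1 := by positivity
      obtain ⟨D, m, hg, hf, -⟩ := exists_gadget_fill_eq hW huv hu hv (|c| + 1)
        (fun _ => hodd.hasIndirectPath hod.2) (fun h => absurd h (not_le.2 hpos'))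
      exact ⟨D, m, hg, by rw [hf]; linarith [le_abs_self c]⟩
    · have hc0 := hneg hodd hod.1
      obtain ⟨D, m, hg, hf⟩ := exists_gadget_small H W u v (neg_pos.2 hc0)
      exact ⟨D, m, hg, by linarith [(abs_lt.1 hf).1]⟩
  · rw [not_or] at hev
    suffices h : ∃ (D : Matrix W W ℝ) (m : α → α → ℝ), Gadget H D m ∧ fill D m u v < c by
      obtain ⟨D, m, hg, hf⟩ := h
      exact ⟨D, m, hg, ⟨fun _ h => absurd hod h, fun _ _ => by linarith,
        fun h => absurd (Or.inr hod) h⟩, Or.inr (Or.inl hod)⟩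
    by_cases heven : H.HasEvenPath u v
    · have hneg' : -(|c| + 1) < 0 := by linarith [abs_nonneg c]
      obtain ⟨D, m, hg, hf, -⟩ := exists_gadget_fill_eq hW huv hu hv (-(|c| + 1))
        (fun h => absurd h (not_le.2 hneg')) (fun _ => heven.hasIndirectPath hev.2)
      exact ⟨D, m, hg, by rw [hf]; linarith [neg_abs_le c]⟩
    · have hc0 := hpos heven hev.1
      obtain ⟨D, m, hg, hf⟩ := exists_gadget_small H W u v hc0
      exact ⟨D, m, hg, by linarith [(abs_lt.1 hf).2]⟩
  · rw [not_or] at hev hod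
    -- Here `u` and `v` end up nonadjacent: `fill` must cancel `c` exactly, and nondegeneracy has to
    -- stand in for the lost adjacency.
    obtain ⟨D, m, hg, hf, hn⟩ := exists_gadget_fill_eq hW huv hu hv c
      (fun h => by
        refine HasOddPath.hasIndirectPath ?_ hod.2
        by_contra hodd
        exact absurd (hneg hodd hod.1) (not_lt.2 h))
      (fun h => by
        refine HasEvenPath.hasIndirectPath ?_ hev.2
        by_contra heven
        exact absurd (hpos heven hev.1) (not_lt.2 h))
    refine ⟨D, m, hg, ⟨fun h => absurd h (by tauto), fun h => absurd h (by tauto), fun _ => ?_⟩,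
      Or.inr (Or.inr hn)⟩
    rw [hf, sub_self]

namespace TwoSplit

variable {G : SignedGraph α β} (S : TwoSplit G)

/-- The 2-split with its sides exchanged. -/
def swap : TwoSplit G where
  toEdgePartition := S.toEdgePartition.swap
  u := S.u
  v := S.v
  ne := S.ne
  common_eq := (Set.inter_comm _ _).trans S.common_eq
  connected₁ := S.connected₂
  connected₂ := S.connected₁
  not_sub₁ := S.not_sub₂
  not_sub₂ := S.not_sub₁

theorem part₁_evenAdj {x y : α} : S.part₁.EvenAdj x y ↔ S.side₁.EvenAdj x y ∨
    false ∈ S.side₂.replacementSigns S.u S.v ∧ ((x = S.u ∧ y = S.v) ∨ (x = S.v ∧ y = S.u)) :=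
  addEdges_evenAdj

theorem part₁_oddAdj {x y : α} : S.part₁.OddAdj x y ↔ S.side₁.OddAdj x y ∨
    true ∈ S.side₂.replacementSigns S.u S.v ∧ ((x = S.u ∧ y = S.v) ∨ (x = S.v ∧ y = S.u)) :=
  addEdges_oddAdj

theorem replacementSigns_nonempty (K : SignedGraph α β) (u v : α) :
    false ∈ K.replacementSigns u v ∨ true ∈ K.replacementSigns u v := by
  by_cases h : K.HasOddPath u v
  · exact Or.inr (Or.inr (by simpa using h))
  · exact Or.inl (Or.inr (by simpa using h))

theorem part₁_adj : S.part₁.graph.Adj S.u S.v := by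
  rw [adj_iff, part₁_evenAdj, part₁_oddAdj]
  rcases replacementSigns_nonempty S.side₂ S.u S.v with h | h
  · exact Or.inl (Or.inr ⟨h, Or.inl ⟨rfl, rfl⟩⟩)
  · exact Or.inr (Or.inr ⟨h, Or.inl ⟨rfl, rfl⟩⟩)

theorem eq_of_mem_common {x : α} (h : x ∈ S.common) : x = S.u ∨ x = S.v := by
  rw [S.common_eq] at h
  exact h

theorem not_ends {x y : α} (h : x ∉ S.common ∨ y ∉ S.common) :
    ¬ ((x = S.u ∧ y = S.v) ∨ (x = S.v ∧ y = S.u)) := by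
  rintro (⟨rfl, rfl⟩ | ⟨rfl, rfl⟩)
  · exact h.elim (fun h => h S.u_mem) (fun h => h S.v_mem)
  · exact h.elim (fun h => h S.v_mem) (fun h => h S.u_mem)

theorem evenAdj_iff_part₁ {x y : α} (hx : x ∈ V(S.side₁.graph)) (hy : y ∈ V(S.side₁.graph))
    (h : x ∉ S.common ∨ y ∉ S.common) : G.EvenAdj x y ↔ S.part₁.EvenAdj x y := by
  have h1 := S.side₂_not_adj hx hy h
  rw [S.evenAdj_iff, part₁_evenAdj, or_iff_left fun h => h1 h.adj,
    or_iff_left fun h' => S.not_ends h h'.2]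

theorem oddAdj_iff_part₁ {x y : α} (hx : x ∈ V(S.side₁.graph)) (hy : y ∈ V(S.side₁.graph))
    (h : x ∉ S.common ∨ y ∉ S.common) : G.OddAdj x y ↔ S.part₁.OddAdj x y := by
  have h1 := S.side₂_not_adj hx hy h
  rw [S.oddAdj_iff, part₁_oddAdj, or_iff_left fun h => h1 h.adj,
    or_iff_left fun h' => S.not_ends h h'.2]

/-- A symmetric sign pattern on the first side may be checked separately at `u, v`. -/
theorem signPattern_of {γ : Type*} {K : SignedGraph α γ}
    {f : V(S.side₁.graph) → V(S.side₁.graph) → ℝ}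
    (hf : ∀ i j, f i j = f j i)
    (hoff : ∀ i j : V(S.side₁.graph), i ≠ j → ((i : α) ∉ S.common ∨ (j : α) ∉ S.common) →
      SignCond (K.EvenAdj i j) (K.OddAdj i j) (f i j))
    (huv : SignCond (K.EvenAdj S.u S.v) (K.OddAdj S.u S.v) (f ⟨S.u, S.u_mem.1⟩ ⟨S.v, S.v_mem.1⟩)) :
    SignPattern (fun i j : V(S.side₁.graph) => K.EvenAdj i j)
      (fun i j : V(S.side₁.graph) => K.OddAdj i j) f := by
  intro i j hij
  by_cases h : (i : α) ∉ S.common ∨ (j : α) ∉ S.common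
  · exact hoff i j hij h
  · push Not at h
    have hne : (i : α) ≠ j := fun h => hij (Subtype.ext h)
    have hev : K.EvenAdj S.v S.u ↔ K.EvenAdj S.u S.v := ⟨EvenAdj.symm, EvenAdj.symm⟩
    have hod : K.OddAdj S.v S.u ↔ K.OddAdj S.u S.v := ⟨OddAdj.symm, OddAdj.symm⟩
    obtain ⟨i, hi⟩ := i
    obtain ⟨j, hj⟩ := j
    rcases S.eq_of_mem_common h.1 with h1 | h1 <;> rcases S.eq_of_mem_common h.2 with h2 | h2 <;>
      simp only at h1 h2 <;> subst h1 <;> subst h2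
    · exact absurd rfl hne
    · exact huv
    · simp only [hev, hod]
      rw [hf]
      exact huv
    · exact absurd rfl hne

theorem subset_union : V(S.side₂.graph) ⊆ (V(G.graph) \ V(S.part₁.graph)) ∪ {S.u, S.v} := by
  intro x hx
  by_cases h : x ∈ V(S.side₁.graph)
  · exact Or.inr (S.eq_of_mem_common ⟨h, hx⟩)
  · exact Or.inl ⟨S.toEdgePartition.swap.side₁_subset hx, h⟩

/-- The contribution of a bipartite second side. -/
theorem fill_sign [Fintype ↥(V(G.graph) \ V(S.part₁.graph))]
    [DecidableEq ↥(V(G.graph) \ V(S.part₁.graph))] (hb : S.side₂.IsBipartite)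
    {D : Matrix ↥(V(G.graph) \ V(S.part₁.graph)) ↥(V(G.graph) \ V(S.part₁.graph)) ℝ}
    {m : α → α → ℝ} (hg : Gadget G D m) {p : Walk S.side₂ S.u S.v} (hp : p.IsPath) :
    (-1) ^ p.oddCount * fill D m S.u S.v ≤ 0 ∧
    ((-1) ^ p.oddCount * fill D m S.u S.v < 0 ∨ S.side₂.graph.Adj S.u S.v) ∧
    ∀ e, S.side₂.graph.IsLink e S.u S.v → S.side₂.edgeSign e = (-1) ^ p.oddCount := by
  -- After switching, all edges of the side are even, so all its edges and paths between `u` and `v`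
  -- share the sign $\sigma_u\sigma_v$.
  obtain ⟨σ, hσ, hσe⟩ := hb.exists_switching S.connected₂
  rw [← p.switching_eq hσ fun e _ => hσe e]
  have hu : S.u ∉ V(G.graph) \ V(S.part₁.graph) := fun h => h.2 S.u_mem.1
  have hv : S.v ∉ V(G.graph) \ V(S.part₁.graph) := fun h => h.2 S.v_mem.1
  have hneg' : ∀ e, ∀ x, ∀ w ∈ V(G.graph) \ V(S.part₁.graph), x ≠ w →
      S.side₂.graph.IsLink e x w → σ x * σ w * m x w < 0 := by
    intro e x w hw hne hl
    obtain ⟨h1, h2, -⟩ := hg.pattern x w hne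
    rw [S.evenAdj_of_notMem hw.2, S.oddAdj_of_notMem hw.2] at h1 h2
    rw [hσe e x w hl]
    by_cases he : e ∈ S.side₂.odd
    · have hno : ¬ S.side₂.EvenAdj x w := by
        rintro ⟨e', he', hl'⟩
        have h3 := hσe e x w hl
        rw [hσe e' x w hl', edgeSign_of_odd he, edgeSign_of_even he'] at h3
        norm_num at h3
      have := h2 ⟨e, he, hl⟩ hno
      rw [edgeSign_of_odd he]
      linarith
    · have hno : ¬ S.side₂.OddAdj x w := by
        rintro ⟨e', he', hl'⟩
        have h3 := hσe e x w hl
        rw [hσe e' x w hl', edgeSign_of_odd he', edgeSign_of_even he] at h3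
        norm_num at h3
      have := h1 ⟨e, he, hl⟩ hno
      rw [edgeSign_of_even he]
      linarith
  have hneg : ∀ (x : α) (w : ↥(V(G.graph) \ V(S.part₁.graph))), x ≠ w →
      σ x * σ w * m x w ≤ 0 := by
    intro x w hne
    by_cases hadj : S.side₂.graph.Adj x w
    · obtain ⟨e, hl⟩ := hadj
      exact (hneg' e x w w.2 hne hl).le
    · rw [S.gadget_eq_zero hg (fun w hw => hw.2) x w w.2 hne hadj, mul_zero]
  refine ⟨switched_fill_nonpos hg.posDef hg.off_diag hσ hneg hu hv, ?_,
    fun e he => (hσe e _ _ he).symm⟩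
  by_cases hadj : S.side₂.graph.Adj S.u S.v
  · exact Or.inr hadj
  · refine Or.inl (switched_fill_neg hg.posDef hg.off_diag hg.comm hσ hneg S.ne hu hv hp
      (fun y hy => S.subset_union (p.mem_vertexSet_of_mem_support hy))
      (fun e _ hl => hadj ⟨e, hl⟩) fun e _ y z hl hz => ?_)
    refine hneg' e y z hz ?_ hl
    rintro rfl
    have := S.side₂.loopless
    exact S.side₂.graph.not_isLoopAt e y hl

/-- For a bipartite side, `fill` weakly has the sign of the replacement edge. It is strict unless
the side joins `u` and `v` directly, and then the entry of `m` supplies strictness if no edge of the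
other parity is present. For a nonbipartite side both signs occur and nothing is imposed. -/
theorem signCond_part₁ [Fintype ↥(V(G.graph) \ V(S.part₁.graph))]
    [DecidableEq ↥(V(G.graph) \ V(S.part₁.graph))]
    {D : Matrix ↥(V(G.graph) \ V(S.part₁.graph)) ↥(V(G.graph) \ V(S.part₁.graph)) ℝ}
    {m : α → α → ℝ} (hg : Gadget G D m) :
    SignCond (S.part₁.EvenAdj S.u S.v) (S.part₁.OddAdj S.u S.v)
      (m S.u S.v + fill D m S.u S.v) := by
  have hnone : ¬ (S.part₁.EvenAdj S.u S.v ∨ S.part₁.OddAdj S.u S.v) →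
      m S.u S.v + fill D m S.u S.v = 0 := fun h => absurd ((adj_iff _ _ _).1 S.part₁_adj) h
  by_cases hb : S.side₂.IsBipartite
  · obtain ⟨h1, h2, h3⟩ := hg.pattern S.u S.v S.ne
    by_cases hodd : S.side₂.HasOddPath S.u S.v
    · have hod : S.part₁.OddAdj S.u S.v :=
        S.part₁_oddAdj.2 (Or.inr ⟨Or.inr (by simpa using hodd), Or.inl ⟨rfl, rfl⟩⟩)
      obtain ⟨p, hp, ho⟩ := hodd
      obtain ⟨f1, f2, f3⟩ := S.fill_sign hb hg hp
      rw [ho.neg_one_pow] at f1 f2 f3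
      refine ⟨fun _ h => absurd hod h, fun _ hev => ?_, hnone⟩
      have hno : ¬ G.EvenAdj S.u S.v := by
        rw [S.evenAdj_iff]
        rintro (h | ⟨e, he, hl⟩)
        · exact hev (S.part₁_evenAdj.2 (Or.inl h))
        · have := f3 e hl
          rw [edgeSign_of_even he] at this
          norm_num at this
      by_cases hG : G.OddAdj S.u S.v
      · have := h2 hG hno
        linarith
      · rw [h3 (by tauto)]
        rcases f2 with f2 | f2
        · linarith
        · exact absurd ((adj_iff _ _ _).1 ((S.adj_iff_or _ _).2 (Or.inr f2))) (by tauto)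
    · have hev : S.part₁.EvenAdj S.u S.v :=
        S.part₁_evenAdj.2 (Or.inr ⟨Or.inr (by simpa using hodd), Or.inl ⟨rfl, rfl⟩⟩)
      obtain ⟨p, hp, ho⟩ := (S.connected₂.hasOddPath_or S.u_mem.2 S.v_mem.2).resolve_left hodd
      obtain ⟨f1, f2, f3⟩ := S.fill_sign hb hg hp
      rw [ho.neg_one_pow] at f1 f2 f3
      refine ⟨fun _ hod => ?_, fun _ h => absurd hev h, hnone⟩
      have hno : ¬ G.OddAdj S.u S.v := by
        rw [S.oddAdj_iff]
        rintro (h | ⟨e, he, hl⟩)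
        · exact hod (S.part₁_oddAdj.2 (Or.inl h))
        · have := f3 e hl
          rw [edgeSign_of_odd he] at this
          norm_num at this
      by_cases hG : G.EvenAdj S.u S.v
      · have := h1 hG hno
        linarith
      · rw [h3 (by tauto)]
        rcases f2 with f2 | f2
        · linarith
        · exact absurd ((adj_iff _ _ _).1 ((S.adj_iff_or _ _).2 (Or.inr f2))) (by tauto)
  · exact ⟨fun _ h => absurd (S.part₁_oddAdj.2 (Or.inr ⟨Or.inl hb, Or.inl ⟨rfl, rfl⟩⟩)) h,
      fun _ h => absurd (S.part₁_evenAdj.2 (Or.inr ⟨Or.inl hb, Or.inl ⟨rfl, rfl⟩⟩)) h, hnone⟩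

/-! ### Nullities of a graph and of the parts of its 2-split -/

theorem part₁_isNullity [Finite α] {k : ℕ} [Fintype V(G.graph)]
    {A : Matrix V(G.graph) V(G.graph) ℝ}
    (hA : Realizes (fun i j : V(G.graph) => G.EvenAdj i j)
      (fun i j : V(G.graph) => G.OddAdj i j) A k)
    (hD : (A.submatrix (Set.inclusion (Set.sdiff_subset (t := V(S.side₁.graph))))
      (Set.inclusion Set.sdiff_subset)).PosDef) : S.part₁.IsNullity k := by
  classical
  let : Fintype V(S.part₁.graph) := Fintype.ofFinite _
  let : Fintype ↥(V(G.graph) \ V(S.part₁.graph)) := Fintype.ofFinite _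
  refine isNullity_reduce (G₁ := S.part₁) S.side₁_subset hA hD S.common ?_ ?_ ?_ ?_
  · intro x hx w hw hadj
    exact ⟨hx, ((S.adj_of_notMem hw.2).1 hadj).left_mem⟩
  · intro x _ y _ hx hy
    rcases S.eq_of_mem_common hx with rfl | rfl <;> rcases S.eq_of_mem_common hy with rfl | rfl
    · exact Or.inr rfl
    · exact Or.inl S.part₁_adj
    · exact Or.inl S.part₁_adj.symm
    · exact Or.inr rfl
  · intro x hx y hy hadj
    by_cases h : x ∉ S.common ∨ y ∉ S.common
    · rw [adj_iff, ← S.evenAdj_iff_part₁ hx hy h, ← S.oddAdj_iff_part₁ hx hy h, ← adj_iff]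
      exact hadj
    · push Not at h
      have hxy : x ≠ y := by
        rintro rfl
        obtain ⟨e, he⟩ := hadj
        have := G.loopless
        exact G.graph.not_isLoopAt e x he
      rcases S.eq_of_mem_common h.1 with rfl | rfl <;>
        rcases S.eq_of_mem_common h.2 with rfl | rfl
      · exact absurd rfl hxy
      · exact S.part₁_adj
      · exact S.part₁_adj.symm
      · exact absurd rfl hxy
  · intro D m hg
    refine S.signPattern_of (K := S.part₁) (fun i j => ?_) (fun i j hij h => ?_)
      (S.signCond_part₁ hg)
    · rw [hg.comm, fill_comm hg.posDef]
    · rw [← S.evenAdj_iff_part₁ i.2 j.2 h, ← S.oddAdj_iff_part₁ i.2 j.2 h,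
        S.fill_eq_zero hg.posDef (fun w hw => hw.2) (S.gadget_eq_zero hg fun w hw => hw.2) i.2 j.2
        h, add_zero]
      exact hg.pattern i j (fun h => hij (Subtype.ext h))

theorem isNullity_of_part₁ [Finite α]
    (hpar : ¬ S.side₂.IsBipartite → S.side₂.HasOddPath S.u S.v ∧ S.side₂.HasEvenPath S.u S.v)
    {k : ℕ} (h : S.part₁.IsNullity k) : G.IsNullity k := by
  classical
  let : Fintype V(S.part₁.graph) := Fintype.ofFinite _
  let : Fintype ↥(V(G.graph) \ V(S.part₁.graph)) := Fintype.ofFinite _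
  obtain ⟨A, hA⟩ := (mem_nullities_iff S.part₁ k).1 h
  have hu : S.u ∉ V(G.graph) \ V(S.part₁.graph) := fun h => h.2 S.u_mem.1
  have hv : S.v ∉ V(G.graph) \ V(S.part₁.graph) := fun h => h.2 S.v_mem.1
  let u' : V(S.part₁.graph) := ⟨S.u, S.u_mem.1⟩
  let v' : V(S.part₁.graph) := ⟨S.v, S.v_mem.1⟩
  have huv' : u' ≠ v' := fun h => S.ne (congrArg Subtype.val h)
  have hsc : SignCond (S.side₁.EvenAdj S.u S.v ∨ false ∈ S.side₂.replacementSigns S.u S.v)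
      (S.side₁.OddAdj S.u S.v ∨ true ∈ S.side₂.replacementSigns S.u S.v) (A u' v') := by
    have h1 : SignCond (S.part₁.EvenAdj S.u S.v) (S.part₁.OddAdj S.u S.v) (A u' v') :=
      hA.pattern u' v' huv'
    rw [part₁_evenAdj, part₁_oddAdj] at h1
    simpa using h1
  obtain ⟨D, m, hg, hsc', hnd⟩ := exists_gadget_signCond S.subset_union S.ne hu hv S.connected₂
    hpar S.u_mem.2 S.v_mem.2 hsc
  rw [← S.evenAdj_iff, ← S.oddAdj_iff] at hsc' hnd
  have hm : ∀ x, ∀ w ∈ V(G.graph) \ V(S.part₁.graph), x ≠ w → ¬ S.side₂.graph.Adj x w →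
      m x w = 0 := fun x w hw hne hadj =>
    (hg.pattern x w hne).2.2 (by rwa [← adj_iff])
  refine isNullity_extend (G₁ := S.part₁) S.side₁_subset hA hg
    (fun x w hw => S.evenAdj_of_notMem hw.2) (fun x w hw => S.oddAdj_of_notMem hw.2) ?_ ?_
  · refine S.signPattern_of (K := G) (fun i j => ?_) (fun i j hij h => ?_) hsc'
    · rw [fill_comm hg.posDef]
      congr 1
      exact hA.isSymm.apply j i
    · rw [S.evenAdj_iff_part₁ i.2 j.2 h, S.oddAdj_iff_part₁ i.2 j.2 h,
        S.fill_eq_zero hg.posDef (fun w hw => hw.2) hm i.2 j.2 h, sub_zero]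
      exact hA.pattern i j hij
  · intro Y hY h1 h2 h3
    have hdiag : ∀ i, Y i i = 0 := fun i => h1 i i (Or.inr rfl)
    have hYvu : Y v' u' = Y u' v' := hY.apply u' v'
    have hpot : ∀ (i : V(S.part₁.graph)), i ≠ u' → i ≠ v' → potential D m i = 0 := by
      intro i hi hi'
      refine S.potential_eq_zero (fun w hw => hw.2) hm i.2 fun hc => ?_
      rcases S.eq_of_mem_common hc with h | h
      · exact hi (Subtype.ext h)
      · exact hi' (Subtype.ext h)
    have hsum : ∀ F : V(S.part₁.graph) → ℝ, (∀ i, i ≠ u' → i ≠ v' → F i = 0) →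
        ∑ i, F i = F u' + F v' := fun F hF =>
      Fintype.sum_eq_add u' v' huv' fun i hi => hF i hi.1 hi.2
    have hYp : ∀ i w, ∑ j : V(S.part₁.graph), Y i j * potential D m j w =
        Y i u' * potential D m S.u w + Y i v' * potential D m S.v w := fun i w =>
      hsum _ fun j hj hj' => by rw [hpot j hj hj', Pi.zero_apply, mul_zero]
    -- Only `u` and `v` have nonzero potentials, so the blocks of the lifted matrix that involve `W`
    -- are multiples of this entry, apart from the rows of noncommon vertices. Each alternative of
    -- `Nondegenerate` names a prescribed zero whose coefficient is nonzero.
    have hYuv : Y u' v' = 0 := by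
      have hadj_of : ∀ x, ∀ w ∈ V(G.graph) \ V(S.part₁.graph), S.side₂.graph.Adj x w →
          G.graph.Adj x w := fun x w _ h => (S.adj_iff_or _ _).2 (Or.inr h)
      rcases hnd with h | h | h
      · exact h1 u' v' (Or.inl h.adj)
      · exact h1 u' v' (Or.inl h.adj)
      · rcases h with ⟨w, hw, hne⟩ | ⟨w, hw, hne⟩ | ⟨w, w', hw, hne⟩
        · have := h2 u' w (hadj_of _ _ w.2 hw)
          rw [hYp, hdiag, zero_mul, zero_add] at this
          exact (mul_eq_zero.1 this).resolve_right hne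
        · have := h2 v' w (hadj_of _ _ w.2 hw)
          rw [hYp, hdiag, zero_mul, add_zero, hYvu] at this
          exact (mul_eq_zero.1 this).resolve_right hne
        · have := h3 w w' (hw.imp_left (hadj_of _ _ w'.2))
          simp only [hYp] at this
          rw [hsum _ fun j hj hj' => by rw [hpot j hj hj', Pi.zero_apply, zero_mul], hdiag, hdiag,
            hYvu] at this
          refine (mul_eq_zero.1 (?_ : Y u' v' * _ = 0)).resolve_right hne
          simp only [u', v'] at this ⊢
          linarith
    intro i j hij
    by_cases h : (i : α) ∉ S.common ∨ (j : α) ∉ S.common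
    · refine h1 i j (Or.inl ?_)
      rw [adj_iff, S.evenAdj_iff_part₁ i.2 j.2 h, S.oddAdj_iff_part₁ i.2 j.2 h, ← adj_iff]
      exact hij
    · push Not at h
      rcases S.eq_of_mem_common h.1 with hi | hi <;> rcases S.eq_of_mem_common h.2 with hj | hj
      · obtain rfl : i = u' := Subtype.ext hi
        obtain rfl : j = u' := Subtype.ext hj
        exact hdiag _
      · obtain rfl : i = u' := Subtype.ext hi
        obtain rfl : j = v' := Subtype.ext hj
        exact hYuv
      · obtain rfl : i = v' := Subtype.ext hi
        obtain rfl : j = u' := Subtype.ext hj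
        rw [hYvu, hYuv]
      · obtain rfl : i = v' := Subtype.ext hi
        obtain rfl : j = v' := Subtype.ext hj
        exact hdiag _

theorem isNullity_iff [Finite α]
    (h₁ : ¬ S.side₁.IsBipartite → S.side₁.HasOddPath S.u S.v ∧ S.side₁.HasEvenPath S.u S.v)
    (h₂ : ¬ S.side₂.IsBipartite → S.side₂.HasOddPath S.u S.v ∧ S.side₂.HasEvenPath S.u S.v)
    (k : ℕ) : G.IsNullity k ↔ S.part₁.IsNullity k ∨ S.part₂.IsNullity k := by
  constructor
  · intro h
    let : Fintype V(G.graph) := Fintype.ofFinite _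
    obtain ⟨A, hA⟩ := (mem_nullities_iff G k).1 h
    rcases S.toEdgePartition.posDef_or hA with hD | hD | rfl
    · exact Or.inl (S.part₁_isNullity hA hD)
    · exact Or.inr (S.swap.part₁_isNullity hA hD)
    -- In the exceptional case the nullity 1 need not come from `A`: the part attains it anyway.
    · exact Or.inl (isNullity_one (G := S.part₁) S.side₁_nonempty.some_mem)
  · rintro (h | h)
    · exact S.isNullity_of_part₁ h₂ h
    · exact S.swap.isNullity_of_part₁ h₁ h

end TwoSplit

end SignedGraph

theorem mainTheorem2 {α β : Type*} [Finite α] [Finite β] (G : SignedGraph α β) :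
    (∀ (k : ℕ) (G₁ G₂ : SignedGraph α β), SignedGraph.FormSplit k G G₁ G₂ →
      G.nu = max G₁.nu G₂.nu) ∧
    (∀ S : SignedGraph.TwoSplit G,
      (¬ S.side₁.IsBipartite → S.side₁.HasOddPath S.u S.v ∧ S.side₁.HasEvenPath S.u S.v) →
      (¬ S.side₂.IsBipartite → S.side₂.HasOddPath S.u S.v ∧ S.side₂.HasEvenPath S.u S.v) →
      G.nu = max S.part₁.nu S.part₂.nu) := by
  constructor
  · rintro k G₁ G₂ ⟨hk, S, hS, rfl, rfl⟩
    refine SignedGraph.nu_eq_max (S.isNullity_iff ?_)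
    rw [← Set.encard_le_one_iff_subsingleton, hS]
    exact_mod_cast hk
  · intro S h₁ h₂
    exact SignedGraph.nu_eq_max (S.isNullity_iff h₁ h₂)
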